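/- Let $\mathbb K$ be an algebraically closed field of characteristic zero, let $L$ be a finite-dimensional semisimple Lie algebra over $\mathbb K$ and let $I$ be a finite-dimensional $L$-module. Suppose that there is a finite-dimensional irreducible $L$-module $M$ such that, in a decomposition of $I\otimes M$ into a direct sum of indecomposable $L$-modules (which is unique up to isomorphism and order), one of the following holds: 1. there are five pairwise non-isomorphic indecomposable components; 2. some indecomposable component has multiplicity at least $3$; 3. some indecomposable component has multiplicity $2$ and there is another component, not isomorphic to it. Then the Lie algebra $L\ltimes I$ (the semidirect sum in which $I$ is an abelian ideal on which $L$ acts by the module structure) is controlled wild. Here a Lie algebra $\mathfrak g$ over $\mathbb K$ is called controlled wild if for every finitely generated associative unital $\mathbb K$-algebra $B$ there are a faithful exact $\mathbb K$-linear functor $F$ from the category of finite-dimensional $B$-modules to the category of finite-dimensional representations of $\mathfrak g$, and a class $\mathcal C$ of finite-dimensional representations of $\mathfrak g$ closed under finite direct sums and direct summands, such that for all finite-dimensional $B$-modules $X,Y$ $$\operatorname{Hom}_{\mathfrak g}(FX,FY)=F\bigl(\operatorname{Hom}_B(X,Y)\bigr)\oplus \operatorname{Hom}_{\mathfrak g}(FX,FY)_{\mathcal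 C},\qquad \operatorname{Hom}_{\mathfrak g}(FX,FY)_{\mathcal C}\subseteq \operatorname{rad}(FX,FY).$$ Here $\operatorname{Hom}_{\mathfrak g}(V,W)_{\mathcal C}$ is the set of morphisms $V\to W$ that factor through an object of $\mathcal C$, and $\operatorname{rad}(V,W)$ is the set of morphisms $f\colon V\to W$ such that $\mathrm{id}_V-hf$ is invertible for every morphism $h\colon W\to V$. -/

import Mathlib

open CategoryTheory
open scoped TensorProduct ModuleCat.Algebra

universe u

/-! ### Finite-dimensional representations of a Lie algebra -/

/-- A finite-dimensional representation of the Lie algebra `g` over the field `K`. -/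
structure FinDimLieRep (K : Type u) [Field K] (g : Type u) [LieRing g] [LieAlgebra K g] where
  carrier : Type u
  [addCommGroup : AddCommGroup carrier]
  [module : Module K carrier]
  [lieRingModule : LieRingModule g carrier]
  [lieModule : LieModule K g carrier]
  [finiteDimensional : FiniteDimensional K carrier]

namespace FinDimLieRep

attribute [instance] addCommGroup module lieRingModule lieModule finiteDimensional

variable {K : Type u} [Field K] {g : Type u} [LieRing g] [LieAlgebra K g]

/-- Morphisms of representations are the `K`-linear maps commuting with the action of `g`. -/
instance : Category.{u} (FinDimLieRep K g) where
  Hom V W := V.carrier →ₗ⁅K, g⁆ W.carrier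
  id V := LieModuleHom.id
  comp f h := LieModuleHom.comp h f

/-- The homomorphism of Lie modules underlying a morphism. -/
def toHom {V W : FinDimLieRep K g} (f : V ⟶ W) : V.carrier →ₗ⁅K, g⁆ W.carrier := f

instance : Preadditive (FinDimLieRep K g) where
  homGroup V W := inferInstanceAs (AddCommGroup (V.carrier →ₗ⁅K, g⁆ W.carrier))
  add_comp V W X f f' h := by
    apply LieModuleHom.ext
    intro x
    exact map_add (toHom h) (toHom f x) (toHom f' x)
  comp_add V W X f h h' := rfl

instance : Linear K (FinDimLieRep K g) where
  homModule V W := inferInstanceAs (Module K (V.carrier →ₗ⁅K, g⁆ W.carrier))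
  smul_comp V W X c f h := by
    apply LieModuleHom.ext
    intro x
    exact map_smul (toHom h) c (toHom f x)
  comp_smul V W X f c h := rfl

end FinDimLieRep

/-- The category of modules over the `K`-algebra `B` that are finite-dimensional over `K`. -/
abbrev FinDimMod (K : Type u) [Field K] (B : Type u) [Ring B] [Algebra K B] :=
  ObjectProperty.FullSubcategory (fun X : ModuleCat.{u} B => FiniteDimensional K X)

/-! ### Controlled wildness -/

/-- The morphism `f` factors through an object of the class `C`. -/
def FactorsThroughClass {A : Type*} [Category A] (C : ObjectProperty A) {V W : A}
    (f : V ⟶ W) : Prop :=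
  ∃ (Z : A) (a : V ⟶ Z) (b : Z ⟶ W), C Z ∧ f = a ≫ b

/-- The class `C` of objects is closed under finite direct sums (the empty one included) and
under direct summands. -/
structure IsClosedUnderSumsAndSummands {A : Type*} [Category A] [Preadditive A]
    (C : ObjectProperty A) : Prop where
  zero : ∀ Z : A, Limits.IsZero Z → C Z
  sum : ∀ (Z₁ Z₂ : A) (b : Limits.BinaryBicone Z₁ Z₂), Nonempty b.IsBilimit →
    C Z₁ → C Z₂ → C b.pt
  summand : ∀ (Z₁ Z₂ : A) (b : Limits.BinaryBicone Z₁ Z₂), Nonempty b.IsBilimit →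
    C b.pt → C Z₁

/-- The radical of a preadditive category: `f : V ⟶ W` is radical if `1 - h ∘ f` is invertible
for every `h : W ⟶ V`. -/
def IsRadicalMorphism {A : Type*} [Category A] [Preadditive A] {V W : A} (f : V ⟶ W) : Prop :=
  ∀ h : W ⟶ V, IsIso (𝟙 V - f ≫ h)

/-- The functor `F` sends short exact sequences to short exact sequences. -/
def PreservesShortExact {K : Type u} [Field K] {B : Type u} [Ring B] [Algebra K B]
    {g : Type u} [LieRing g] [LieAlgebra K g] (F : FinDimMod K B ⥤ FinDimLieRep K g) : Prop :=
  ∀ (X Y Z : FinDimMod K B) (i : X ⟶ Y) (p : Y ⟶ Z),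
    Function.Injective i.hom.hom → Function.Exact i.hom.hom p.hom.hom →
    Function.Surjective p.hom.hom →
      Function.Injective (FinDimLieRep.toHom (F.map i)) ∧
      Function.Exact (FinDimLieRep.toHom (F.map i)) (FinDimLieRep.toHom (F.map p)) ∧
      Function.Surjective (FinDimLieRep.toHom (F.map p))

/-- The functor `F` is controlled by the class `C`: for all `X`, `Y`,
`Hom(F X, F Y) = F(Hom(X, Y)) ⊕ Hom(F X, F Y)_C` and `Hom(F X, F Y)_C ⊆ rad(F X, F Y)`, where
`Hom(F X, F Y)_C` consists of the morphisms that factor through an object of `C`. -/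
structure IsControlledBy {A₁ A₂ : Type*} [Category A₁] [Category A₂] [Preadditive A₂]
    (F : A₁ ⥤ A₂) (C : ObjectProperty A₂) : Prop where
  exists_add : ∀ (X Y : A₁) (f : F.obj X ⟶ F.obj Y),
    ∃ (h : X ⟶ Y) (c : F.obj X ⟶ F.obj Y), FactorsThroughClass C c ∧ f = F.map h + c
  disjoint : ∀ (X Y : A₁) (h : X ⟶ Y), FactorsThroughClass C (F.map h) → F.map h = 0
  radical : ∀ (X Y : A₁) (c : F.obj X ⟶ F.obj Y), FactorsThroughClass C c → IsRadicalMorphism c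

/-- The Lie algebra `g` is controlled wild: for every finitely generated associative unital
`K`-algebra `B` there is a faithful exact `K`-linear functor from the finite-dimensional
`B`-modules to the finite-dimensional representations of `g` that is controlled by some class
of representations closed under finite direct sums and direct summands. -/
def IsControlledWild (K : Type u) [Field K] (g : Type u) [LieRing g] [LieAlgebra K g] : Prop :=
  ∀ (B : Type u) [Ring B] [Algebra K B] [Algebra.FiniteType K B],
    ∃ (F : FinDimMod K B ⥤ FinDimLieRep K g) (_ : F.Additive)
      (C : ObjectProperty (FinDimLieRep K g)),
      F.Linear K ∧ F.Faithful ∧ PreservesShortExact F ∧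
      IsClosedUnderSumsAndSummands C ∧ IsControlledBy F C

/-! ### The semidirect sum of a Lie algebra and a module -/

/-- The vector space `I` regarded as an abelian Lie algebra. -/
def AbelianLie (I : Type u) : Type u := I

namespace AbelianLie

variable {K : Type u} [Field K] {L : Type u} [LieRing L] [LieAlgebra K L]
  {I : Type u} [AddCommGroup I] [Module K I] [LieRingModule L I] [LieModule K L I]

instance : AddCommGroup (AbelianLie I) := inferInstanceAs (AddCommGroup I)

instance : Module K (AbelianLie I) := inferInstanceAs (Module K I)

instance : LieRing (AbelianLie I) where
  bracket _ _ := 0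
  add_lie _ _ _ := (add_zero 0).symm
  lie_add _ _ _ := (add_zero 0).symm
  lie_self _ := rfl
  leibniz_lie _ _ _ := (add_zero 0).symm

instance : LieAlgebra K (AbelianLie I) where
  lie_smul t _ _ := (smul_zero t).symm

variable (K L I) in
/-- The action of `L` on the module `I`, as an action by derivations of the abelian
Lie algebra `I`. -/
def action : L →ₗ⁅K⁆ LieDerivation K (AbelianLie I) (AbelianLie I) where
  toFun x :=
    { toLinearMap := (LieModule.toEnd K L I x : I →ₗ[K] I)
      leibniz' := fun a b => by
        change ⁅x, (0 : I)⁆ = (0 : I) - 0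
        rw [lie_zero, sub_zero] }
  map_add' x y := by
    ext a
    exact add_lie x y (show I from a)
  map_smul' t x := by
    ext a
    exact smul_lie t x (show I from a)
  map_lie' := by
    intro x y
    ext a
    rw [LieDerivation.lie_apply]
    exact lie_lie x y (show I from a)

end AbelianLie

/-- The semidirect sum `L ⋉ I` of the Lie algebra `L` and the `L`-module `I`, in which `I` is an
abelian ideal. -/
abbrev SemidirectModule (K L I : Type u) [Field K] [LieRing L] [LieAlgebra K L]
    [AddCommGroup I] [Module K I] [LieRingModule L I] [LieModule K L I] : Type u :=
  LieAlgebra.SemiDirectSum (AbelianLie I) L (AbelianLie.action K L I)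

/-! ### Indecomposable components -/

/-- The Lie module `V` is indecomposable. -/
def IsIndecomposableLieModule (K L V : Type*) [Field K] [LieRing L] [LieAlgebra K L]
    [AddCommGroup V] [Module K V] [LieRingModule L V] [LieModule K L V] : Prop :=
  Nontrivial V ∧ ∀ A B : LieSubmodule K L V, IsCompl A B → A = ⊥ ∨ B = ⊥

/-- `V` is the internal direct sum of the indecomposable submodules `N i`. -/
structure IsIndecomposableDecomposition {K L V ι : Type*} [Field K] [LieRing L] [LieAlgebra K L]
    [AddCommGroup V] [Module K V] [LieRingModule L V] [LieModule K L V]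
    (N : ι → LieSubmodule K L V) : Prop where
  independent : iSupIndep N
  sup_eq_top : ⨆ i, N i = ⊤
  indecomposable : ∀ i, IsIndecomposableLieModule K L (N i)

/-- The components `N i` and `N j` are isomorphic. -/
def IsoComponents {K L V ι : Type*} [Field K] [LieRing L] [LieAlgebra K L]
    [AddCommGroup V] [Module K V] [LieRingModule L V] [LieModule K L V]
    (N : ι → LieSubmodule K L V) (i j : ι) : Prop :=
  Nonempty (N i ≃ₗ⁅K, L⁆ N j)

/-- The multiplicity of the component `N i` in the family `N`. -/
noncomputable def componentMultiplicity {K L V ι : Type*} [Field K] [LieRing L] [LieAlgebra K L]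
    [AddCommGroup V] [Module K V] [LieRingModule L V] [LieModule K L V]
    (N : ι → LieSubmodule K L V) (i : ι) : ℕ :=
  Nat.card {j : ι // IsoComponents N i j}

/-! To a `B`-module `X` attach the representation of `L ⋉ I` on `V₀ ⊕ V₁`, where `V₀ = (M ⊗ X)^σ`
and `V₁ = ∏ N j ⊗ X` for suitable components `N j` of `I ⊗ M`, repeated as needed. `L` acts through
`M` and `N j` only. `I` kills `V₁` and maps `V₀` to `V₁` by projections `I ⊗ M → N j` combined with
matrices over `B` from `X^σ` to `X`. The controlling class consists of the representations on which
`I` acts by zero.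

If no nonzero vector of `V₀` is killed by `I` and the image of `I` generates `V₁`, every morphism is
block diagonal plus an `L`-map `V₀ → V₁'`. The latter are exactly the morphisms through the class,
and they are radical because their composites with any morphism back square to zero
(`TwoStepRep.exists_homMk_add`, `TwoStepRep.isRadicalMorphism_of_factorsThrough`).

By Schur's lemma the block on `V₀` is `id_M ⊗ Φ` with `Φ : X^σ → Y^σ` linear over `K`. Compatibility
with the action of `I` makes `Φ` respect the configuration of subspaces and operators encoded by the
matrices (`ArrowData.IsWild.exists_eq_tensorPiMap`). It remains to choose a configuration whose only
morphisms are the diagonal copies of `B`-linear maps. One is given by an operator `T` with distinct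
eigenvalues and the subspace of all `(u, v, u + b γ v)`, with `b γ` generating `B`
(`exists_eq_of_preserves`).

Two isomorphic components give a pencil `(1, T)`, hence the operator `T`, and a third component
gives the subspace (`ArrowData.isWild_double`). With five components, four encode `T` by the
classical quadruple of subspaces `0 ⊕ U`, `U ⊕ 0`, the diagonal and the graph of `T`, and the fifth
gives the subspace (`ArrowData.isWild_five`). -/

/-! ### Representations of `L ⋉ I` of Loewy type `(V₀, V₁)` -/

/-- Two finite-dimensional representations `V₀`, `V₁` of `L` and an equivariant map
`I ⊗ V₀ → V₁`. -/
structure TwoStepRep (K L I : Type u) [Field K] [LieRing L] [LieAlgebra K L]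
    [AddCommGroup I] [Module K I] [LieRingModule L I] [LieModule K L I] where
  V₀ : Type u
  V₁ : Type u
  [acg₀ : AddCommGroup V₀]
  [acg₁ : AddCommGroup V₁]
  [mod₀ : Module K V₀]
  [mod₁ : Module K V₁]
  [fin₀ : FiniteDimensional K V₀]
  [fin₁ : FiniteDimensional K V₁]
  ρ₀ : L →ₗ[K] Module.End K V₀
  ρ₁ : L →ₗ[K] Module.End K V₁
  map_lie₀ : ∀ x y v, ρ₀ ⁅x, y⁆ v = ρ₀ x (ρ₀ y v) - ρ₀ y (ρ₀ x v)
  map_lie₁ : ∀ x y v, ρ₁ ⁅x, y⁆ v = ρ₁ x (ρ₁ y v) - ρ₁ y (ρ₁ x v)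
  Θ : I →ₗ[K] V₀ →ₗ[K] V₁
  equivariant : ∀ (x : L) (a : I) (v : V₀), ρ₁ x (Θ a v) = Θ ⁅x, a⁆ v + Θ a (ρ₀ x v)

/-! ### The controlling class: representations killed by `I` -/

section TrivialClass

variable (K L I : Type u) [Field K] [LieRing L] [LieAlgebra K L]
    [AddCommGroup I] [Module K I] [LieRingModule L I] [LieModule K L I]

/-- The representations of `L ⋉ I` on which `I` acts trivially. -/
def trivialOnIdeal : ObjectProperty (FinDimLieRep K (SemidirectModule K L I)) :=
  fun V => ∀ (a : AbelianLie I) (v : V.carrier), ⁅(⟨a, 0⟩ : SemidirectModule K L I), v⁆ = 0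

theorem isClosedUnderSumsAndSummands_trivialOnIdeal :
    IsClosedUnderSumsAndSummands (trivialOnIdeal K L I) where
  zero Z hZ a v := by
    have h : FinDimLieRep.toHom (𝟙 Z) ⁅(⟨a, 0⟩ : SemidirectModule K L I), v⁆ = 0 := by
      rw [hZ.eq_of_src (𝟙 Z) 0]; rfl
    exact h
  sum Z₁ Z₂ b hb h₁ h₂ a v := by
    obtain ⟨hb⟩ := hb
    have total : b.fst ≫ b.inl + b.snd ≫ b.inr = 𝟙 _ :=
      Limits.BinaryFan.IsLimit.hom_ext hb.isLimit (by simp) (by simp)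
    have key : ∀ w : b.pt.carrier, w =
        FinDimLieRep.toHom b.inl (FinDimLieRep.toHom b.fst w) +
        FinDimLieRep.toHom b.inr (FinDimLieRep.toHom b.snd w) := fun w =>
      (congrArg (fun f => FinDimLieRep.toHom f w) total).symm
    rw [key ⁅_, v⁆, LieModuleHom.map_lie (FinDimLieRep.toHom b.fst),
      LieModuleHom.map_lie (FinDimLieRep.toHom b.snd), h₁, h₂, map_zero, map_zero,
      add_zero]
  summand Z₁ Z₂ b hb h a v := by
    have key : ∀ w : Z₁.carrier, w = FinDimLieRep.toHom b.fst (FinDimLieRep.toHom b.inl w) :=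
      fun w => (congrArg (fun f => FinDimLieRep.toHom f w) b.inl_fst).symm
    rw [key ⁅_, v⁆, LieModuleHom.map_lie, h, map_zero]

end TrivialClass

/-! ### Two-step representations and the block form of their morphisms -/

namespace TwoStepRep

attribute [instance] acg₀ acg₁ mod₀ mod₁ fin₀ fin₁

variable {K L I : Type u} [Field K] [LieRing L] [LieAlgebra K L]
    [AddCommGroup I] [Module K I] [LieRingModule L I] [LieModule K L I]

/-- The action of `L ⋉ I` on `V₀ × V₁`. -/
def act (D : TwoStepRep K L I) (ξ : SemidirectModule K L I) (v : D.V₀ × D.V₁) : D.V₀ × D.V₁ :=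
  (D.ρ₀ ξ.right v.1, D.ρ₁ ξ.right v.2 + D.Θ (show I from ξ.left) v.1)

/-- The action of `L ⋉ I` on `V₀ × V₁` as a Lie ring module structure. -/
abbrev lieRingModule (D : TwoStepRep K L I) :
    LieRingModule (SemidirectModule K L I) (D.V₀ × D.V₁) where
  bracket := D.act
  add_lie := fun ξ η v => by
    refine Prod.ext ?_ ?_
    · change D.ρ₀ (ξ.right + η.right) v.1 = D.ρ₀ ξ.right v.1 + D.ρ₀ η.right v.1
      rw [map_add]; rfl
    · change D.ρ₁ (ξ.right + η.right) v.2 +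
        D.Θ ((show I from ξ.left) + (show I from η.left)) v.1 =
        (D.ρ₁ ξ.right v.2 + D.Θ (show I from ξ.left) v.1) +
        (D.ρ₁ η.right v.2 + D.Θ (show I from η.left) v.1)
      rw [map_add, map_add, LinearMap.add_apply, LinearMap.add_apply]
      abel
  lie_add := fun ξ v w => by
    refine Prod.ext ?_ ?_
    · exact map_add _ _ _
    · change D.ρ₁ ξ.right (v.2 + w.2) + D.Θ (show I from ξ.left) (v.1 + w.1) =
        (D.ρ₁ ξ.right v.2 + D.Θ (show I from ξ.left) v.1) +
        (D.ρ₁ ξ.right w.2 + D.Θ (show I from ξ.left) w.1)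
      rw [map_add, map_add]
      abel
  leibniz_lie := fun ξ η v => by
    refine Prod.ext ?_ ?_
    · change D.ρ₀ ξ.right (D.ρ₀ η.right v.1) =
        D.ρ₀ ⁅ξ.right, η.right⁆ v.1 + D.ρ₀ η.right (D.ρ₀ ξ.right v.1)
      rw [D.map_lie₀]
      abel
    -- The `0 : I` is the bracket of the two components in the abelian ideal. It matches the left
    -- side because two successive operators from `I` compose to zero.
    · change D.ρ₁ ξ.right (D.ρ₁ η.right v.2 + D.Θ (show I from η.left) v.1) +
          D.Θ (show I from ξ.left) (D.ρ₀ η.right v.1) =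
        (D.ρ₁ ⁅ξ.right, η.right⁆ v.2 +
          D.Θ ((0 : I) + ⁅ξ.right, (show I from η.left)⁆ -
            ⁅η.right, (show I from ξ.left)⁆) v.1) +
        (D.ρ₁ η.right (D.ρ₁ ξ.right v.2 + D.Θ (show I from ξ.left) v.1) +
          D.Θ (show I from η.left) (D.ρ₀ ξ.right v.1))
      rw [D.map_lie₁, map_add, map_add, D.equivariant,
        D.equivariant, zero_add, map_sub, LinearMap.sub_apply]
      abel

theorem lieModule (D : TwoStepRep K L I) :
    letI := D.lieRingModule
    LieModule K (SemidirectModule K L I) (D.V₀ × D.V₁) :=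
  letI := D.lieRingModule
  { smul_lie := fun t ξ v => by
      refine Prod.ext ?_ ?_
      · change D.ρ₀ (t • ξ.right) v.1 = t • D.ρ₀ ξ.right v.1
        rw [map_smul]; rfl
      · change D.ρ₁ (t • ξ.right) v.2 + D.Θ (t • (show I from ξ.left)) v.1 =
          t • (D.ρ₁ ξ.right v.2 + D.Θ (show I from ξ.left) v.1)
        rw [map_smul, map_smul, smul_add]; rfl
    lie_smul := fun t ξ v => by
      refine Prod.ext ?_ ?_
      · exact map_smul _ _ _
      · change D.ρ₁ ξ.right (t • v.2) + D.Θ (show I from ξ.left) (t • v.1) =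
          t • (D.ρ₁ ξ.right v.2 + D.Θ (show I from ξ.left) v.1)
        rw [map_smul, map_smul, smul_add] }

/-- The representation of `L ⋉ I` on `V₀ × V₁` in which `I` maps `V₀` to `V₁` and kills `V₁`. -/
def toRep (D : TwoStepRep K L I) : FinDimLieRep K (SemidirectModule K L I) where
  carrier := D.V₀ × D.V₁
  lieRingModule := D.lieRingModule
  lieModule := D.lieModule

/-- The linear map underlying a morphism. -/
def lin {D D' : TwoStepRep K L I} (f : D.toRep ⟶ D'.toRep) :
    (D.V₀ × D.V₁) →ₗ[K] (D'.V₀ × D'.V₁) :=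
  show D.toRep.carrier →ₗ[K] D'.toRep.carrier from FinDimLieRep.toHom f

theorem lin_act {D D' : TwoStepRep K L I} (f : D.toRep ⟶ D'.toRep)
    (ξ : SemidirectModule K L I) (v : D.V₀ × D.V₁) : lin f (D.act ξ v) = D'.act ξ (lin f v) :=
  LieModuleHom.map_lie (FinDimLieRep.toHom f) ξ v

theorem act_left (D : TwoStepRep K L I) (a : I) (v : D.V₀ × D.V₁) :
    D.act ⟨a, 0⟩ v = (0, D.Θ a v.1) := by
  simp [act]

theorem act_right (D : TwoStepRep K L I) (x : L) (v : D.V₀ × D.V₁) :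
    D.act ⟨(0 : I), x⟩ v = (D.ρ₀ x v.1, D.ρ₁ x v.2) := by
  simp [act]

/-- The morphism given by a lower triangular block matrix. -/
def homMk {D D' : TwoStepRep K L I} (f₀ : D.V₀ →ₗ[K] D'.V₀) (f₁ : D.V₁ →ₗ[K] D'.V₁)
    (t : D.V₀ →ₗ[K] D'.V₁)
    (h₀ : ∀ x v, f₀ (D.ρ₀ x v) = D'.ρ₀ x (f₀ v)) (h₁ : ∀ x v, f₁ (D.ρ₁ x v) = D'.ρ₁ x (f₁ v))
    (ht : ∀ x v, t (D.ρ₀ x v) = D'.ρ₁ x (t v))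
    (hΘ : ∀ a v, f₁ (D.Θ a v) = D'.Θ a (f₀ v)) : D.toRep ⟶ D'.toRep :=
  show D.toRep.carrier →ₗ⁅K, SemidirectModule K L I⁆ D'.toRep.carrier from
  { toLinearMap := show (D.V₀ × D.V₁) →ₗ[K] (D'.V₀ × D'.V₁) from
      (f₀ ∘ₗ LinearMap.fst _ _ _).prod (t ∘ₗ LinearMap.fst _ _ _ + f₁ ∘ₗ LinearMap.snd _ _ _)
    map_lie' := fun {ξ v} => by
      refine Prod.ext ?_ ?_
      · exact h₀ _ _
      · change t (D.ρ₀ ξ.right (show D.V₀ × D.V₁ from v).1) +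
            f₁ (D.ρ₁ ξ.right (show D.V₀ × D.V₁ from v).2 +
              D.Θ (show I from ξ.left) (show D.V₀ × D.V₁ from v).1) =
          D'.ρ₁ ξ.right (t (show D.V₀ × D.V₁ from v).1 + f₁ (show D.V₀ × D.V₁ from v).2) +
            D'.Θ (show I from ξ.left) (f₀ (show D.V₀ × D.V₁ from v).1)
        rw [ht, map_add, map_add, h₁, hΘ, add_assoc] }

theorem lin_homMk {D D' : TwoStepRep K L I} (f₀ : D.V₀ →ₗ[K] D'.V₀) (f₁ : D.V₁ →ₗ[K] D'.V₁)
    (t : D.V₀ →ₗ[K] D'.V₁) (h₀ h₁ ht hΘ) (v : D.V₀ × D.V₁) :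
    lin (homMk f₀ f₁ t h₀ h₁ ht hΘ) v = (f₀ v.1, t v.1 + f₁ v.2) := rfl

theorem lin_comp {D D' D'' : TwoStepRep K L I} (f : D.toRep ⟶ D'.toRep)
    (g : D'.toRep ⟶ D''.toRep) (v : D.V₀ × D.V₁) : lin (f ≫ g) v = lin g (lin f v) := rfl

theorem lin_add {D D' : TwoStepRep K L I} (f g : D.toRep ⟶ D'.toRep) (v : D.V₀ × D.V₁) :
    lin (f + g) v = lin f v + lin g v := rfl

theorem lin_smul {D D' : TwoStepRep K L I} (c : K) (f : D.toRep ⟶ D'.toRep) (v : D.V₀ × D.V₁) :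
    lin (c • f) v = c • lin f v := rfl

theorem hom_ext {D D' : TwoStepRep K L I} {f f' : D.toRep ⟶ D'.toRep}
    (h : ∀ v, lin f v = lin f' v) : f = f' :=
  LieModuleHom.ext h

/-- No nonzero vector of `V₀` is killed by `I`. -/
def IsFaithfulOnTop (D : TwoStepRep K L I) : Prop := ∀ v : D.V₀, (∀ a, D.Θ a v = 0) → v = 0

/-- `V₁` is generated by the image of the action of `I`. -/
def IsGenerated (D : TwoStepRep K L I) : Prop :=
  Submodule.span K {w : D.V₁ | ∃ a v, w = D.Θ a v} = ⊤

/-- `I` kills `V₁`, hence also its image, whose `V₀'`-component must then vanish. So morphisms are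
block triangular. -/
theorem IsFaithfulOnTop.fst_lin_eq_zero {D D' : TwoStepRep K L I} (hD' : D'.IsFaithfulOnTop)
    (f : D.toRep ⟶ D'.toRep) (w : D.V₁) : (lin f (0, w)).1 = 0 := by
  refine hD' _ fun a => ?_
  have h := lin_act f ⟨a, 0⟩ (0, w)
  rw [act_left, act_left, map_zero, ← Prod.zero_eq_mk, map_zero] at h
  exact (congrArg Prod.snd h).symm

/-- A morphism through a representation with trivial action of `I` maps `V₀` to `V₁'` and
kills `V₁`. -/
theorem factorsThrough_trivialOnIdeal {D D' : TwoStepRep K L I} (hD : D.IsGenerated)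
    (hD' : D'.IsFaithfulOnTop) {c : D.toRep ⟶ D'.toRep}
    (hc : FactorsThroughClass (trivialOnIdeal K L I) c) :
    (∀ w : D.V₁, lin c (0, w) = 0) ∧ (∀ v : D.V₀ × D.V₁, (lin c v).1 = 0) := by
  -- `I` annihilates the whole image of `c`. Moving the action before `c` shows that `c` kills the
  -- generators of `V₁`; leaving it after `c` puts the image inside `V₁'`.
  have key : ∀ a v, D'.act ⟨a, 0⟩ (lin c v) = 0 := by
    obtain ⟨Z, f, g, hZ, rfl⟩ := hc
    intro a v
    have h := hZ a (FinDimLieRep.toHom f v)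
    have h' := LieModuleHom.map_lie (FinDimLieRep.toHom g) (⟨a, 0⟩ : SemidirectModule K L I)
      (FinDimLieRep.toHom f v)
    rw [h, map_zero] at h'
    exact h'.symm
  constructor
  · let g : D.V₁ →ₗ[K] D'.V₀ × D'.V₁ := lin c ∘ₗ LinearMap.inr K D.V₀ D.V₁
    have hle : Submodule.span K {w : D.V₁ | ∃ a v, w = D.Θ a v} ≤ LinearMap.ker g := by
      rw [Submodule.span_le]
      rintro _ ⟨a, v, rfl⟩
      have h := key a (v, 0)
      rw [← lin_act, act_left] at h
      exact h
    intro w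
    exact hle (by rw [show Submodule.span K _ = ⊤ from hD]; trivial)
  · intro v
    refine hD' _ fun a => ?_
    have h := key a v
    rw [act_left] at h
    exact congrArg Prod.snd h

/-- `c` maps into `V₁'`, any `h` maps `V₁'` into `V₁`, and `c` kills `V₁`. Hence `c ≫ h` squares to
zero and `𝟙 + c ≫ h` inverts `𝟙 - c ≫ h`. -/
theorem isRadicalMorphism_of_factorsThrough {D D' : TwoStepRep K L I} (hD : D.IsGenerated)
    (hDf : D.IsFaithfulOnTop) (hD' : D'.IsFaithfulOnTop) {c : D.toRep ⟶ D'.toRep}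
    (hc : FactorsThroughClass (trivialOnIdeal K L I) c) : IsRadicalMorphism c := by
  obtain ⟨h₁, h₂⟩ := factorsThrough_trivialOnIdeal hD hD' hc
  intro h
  have hsq : (c ≫ h) ≫ (c ≫ h) = 0 := by
    refine hom_ext fun v => ?_
    rw [lin_comp, lin_comp, lin_comp]
    have e₂ : lin c v = (0, (lin c v).2) := Prod.ext (h₂ v) rfl
    have e₃ : lin h (lin c v) = (0, (lin h (lin c v)).2) :=
      Prod.ext (by rw [e₂]; exact hDf.fst_lin_eq_zero h _) rfl
    rw [e₃, h₁, map_zero]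
    rfl
  exact ⟨𝟙 _ + c ≫ h, by simp only [Preadditive.sub_comp, Preadditive.comp_add, hsq]; simp,
    by simp only [Preadditive.comp_sub, Preadditive.add_comp, hsq]; simp⟩

/-- The representation `V₀` with trivial action of `I`. -/
def top (D : TwoStepRep K L I) : TwoStepRep K L I where
  V₀ := D.V₀
  V₁ := PUnit
  ρ₀ := D.ρ₀
  ρ₁ := 0
  map_lie₀ := D.map_lie₀
  map_lie₁ _ _ _ := rfl
  Θ := 0
  equivariant _ _ _ := rfl

theorem trivialOnIdeal_top (D : TwoStepRep K L I) : trivialOnIdeal K L I D.top.toRep :=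
  fun a v => D.top.act_left a v

/-- Every morphism is the sum of a block diagonal one and one that factors through a
representation with trivial action of `I`. -/
theorem exists_homMk_add {D D' : TwoStepRep K L I} (hD' : D'.IsFaithfulOnTop)
    (f : D.toRep ⟶ D'.toRep) :
    ∃ (f₀ : D.V₀ →ₗ[K] D'.V₀) (f₁ : D.V₁ →ₗ[K] D'.V₁)
      (h₀ : ∀ x v, f₀ (D.ρ₀ x v) = D'.ρ₀ x (f₀ v)) (h₁ : ∀ x v, f₁ (D.ρ₁ x v) = D'.ρ₁ x (f₁ v))
      (hΘ : ∀ a v, f₁ (D.Θ a v) = D'.Θ a (f₀ v)) (c : D.toRep ⟶ D'.toRep),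
      FactorsThroughClass (trivialOnIdeal K L I) c ∧
      f = homMk f₀ f₁ 0 h₀ h₁ (fun _ _ => by simp) hΘ + c := by
  have hF0 : ∀ w, (lin f (0, w)).1 = 0 := hD'.fst_lin_eq_zero f
  have hx : ∀ (x : L) v w, lin f (D.ρ₀ x v, D.ρ₁ x w) =
      (D'.ρ₀ x (lin f (v, w)).1, D'.ρ₁ x (lin f (v, w)).2) := fun x v w => by
    have := lin_act f ⟨(0 : I), x⟩ (v, w)
    rwa [act_right, act_right] at this
  have ha : ∀ (a : I) v w, lin f (0, D.Θ a v) = (0, D'.Θ a (lin f (v, w)).1) := fun a v w => by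
    have := lin_act f ⟨a, 0⟩ (v, w)
    rwa [act_left, act_left] at this
  let f₀ : D.V₀ →ₗ[K] D'.V₀ := LinearMap.fst _ _ _ ∘ₗ lin f ∘ₗ LinearMap.inl _ _ _
  let f₁ : D.V₁ →ₗ[K] D'.V₁ := LinearMap.snd _ _ _ ∘ₗ lin f ∘ₗ LinearMap.inr _ _ _
  let t : D.V₀ →ₗ[K] D'.V₁ := LinearMap.snd _ _ _ ∘ₗ lin f ∘ₗ LinearMap.inl _ _ _
  have h₀ : ∀ x v, f₀ (D.ρ₀ x v) = D'.ρ₀ x (f₀ v) := fun x v => by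
    have := congrArg Prod.fst (hx x v 0)
    rwa [map_zero] at this
  have h₁ : ∀ x v, f₁ (D.ρ₁ x v) = D'.ρ₁ x (f₁ v) := fun x v => by
    have := congrArg Prod.snd (hx x 0 v)
    rwa [map_zero] at this
  have ht : ∀ x v, t (D.ρ₀ x v) = D'.ρ₁ x (t v) := fun x v => by
    have := congrArg Prod.snd (hx x v 0)
    rwa [map_zero] at this
  have hΘ : ∀ a v, f₁ (D.Θ a v) = D'.Θ a (f₀ v) := fun a v => congrArg Prod.snd (ha a v 0)
  refine ⟨f₀, f₁, h₀, h₁, hΘ, homMk 0 0 t (by simp) (by simp) ht (by simp), ?_, ?_⟩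
  -- The off-diagonal block is the projection onto the quotient `V₀`, on which `I` acts by zero,
  -- followed by `t` into `V₁'`.
  · exact ⟨D.top.toRep, homMk (D' := D.top) LinearMap.id 0 0 (fun _ _ => rfl) (fun _ _ => rfl)
      (fun _ _ => rfl) (fun _ _ => rfl),
      homMk (D := D.top) 0 0 t (fun _ _ => by simp) (fun _ _ => by simp) ht
      (fun _ _ => by simp), D.trivialOnIdeal_top, rfl⟩
  · refine hom_ext fun v => ?_
    rw [lin_add, lin_homMk, lin_homMk]
    have hv : v = (v.1, 0) + (0, v.2) := by simp
    conv_lhs => rw [hv, map_add]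
    refine Prod.ext ?_ ?_
    · change _ + (lin f (0, v.2)).1 = (lin f (v.1, 0)).1 + 0
      rw [hF0]
    · change t v.1 + f₁ v.2 = 0 + f₁ v.2 + (t v.1 + 0)
      abel

end TwoStepRep

/-! ### Schur's lemma with coefficients -/

section Schur

variable {K L M : Type*} [Field K] [LieRing L] [LieAlgebra K L]
  [AddCommGroup M] [Module K M] [LieRingModule L M] [LieModule K L M]

/-- An eigenspace of an equivariant map is a nonzero submodule, hence everything. -/
theorem LieModule.exists_eq_smul_of_isIrreducible [IsAlgClosed K] [FiniteDimensional K M]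
    [LieModule.IsIrreducible K L M] (f : M →ₗ[K] M) (hf : ∀ (x : L) m, f ⁅x, m⁆ = ⁅x, f m⁆) :
    ∃ c : K, ∀ m, f m = c • m := by
  have : Nontrivial M := LieModule.nontrivial_of_isIrreducible K L M
  obtain ⟨c, hc⟩ := Module.End.exists_eigenvalue f
  let E : LieSubmodule K L M :=
    { Module.End.eigenspace f c with
      lie_mem := fun {x m} hm => by
        have hm' : f m = c • m := Module.End.mem_eigenspace_iff.1 hm
        exact Module.End.mem_eigenspace_iff.2 (by rw [hf, hm', lie_smul]) }
  have hE : E = ⊤ := by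
    refine (eq_bot_or_eq_top E).resolve_left fun h => ?_
    obtain ⟨v, hv⟩ := hc.exists_hasEigenvector
    have hv' : v ∈ E := hv.1
    rw [h] at hv'
    exact hv.2 ((LieSubmodule.mem_bot v).1 hv')
  refine ⟨c, fun m => Module.End.mem_eigenspace_iff.1 (?_ : m ∈ E)⟩
  rw [hE]
  trivial

/-- A basis of `Y` turns `M ⊗ Y` into a sum of copies of `M` on which operators act coordinatewise.
This reduces statements with coefficients to statements about `M`. -/
theorem TensorProduct.equivFinsuppOfBasisRight_rTensor {M' Y κ : Type*} [AddCommGroup M']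
    [Module K M'] [AddCommGroup Y] [Module K Y] [DecidableEq κ] (b : Module.Basis κ K Y) (T : M →ₗ[K] M')
    (z : M ⊗[K] Y) (k : κ) :
    TensorProduct.equivFinsuppOfBasisRight b (T.rTensor Y z) k =
      T (TensorProduct.equivFinsuppOfBasisRight b z k) := by
  induction z with
  | zero => simp
  | tmul m y => simp
  | add z z' hz hz' => simp [map_add, hz, hz']

theorem TensorProduct.tmul_right_injective_of_ne_zero {Y : Type*} [AddCommGroup Y] [Module K Y]
    {m : M} (hm : m ≠ 0) : Function.Injective fun y : Y => m ⊗ₜ[K] y := by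
  classical
  intro y y' h
  let b := Module.Basis.ofVectorSpace K Y
  refine b.repr.injective (Finsupp.ext fun k => smul_left_injective K hm ?_)
  have := DFunLike.congr_fun (congrArg (TensorProduct.equivFinsuppOfBasisRight (M := M) b) h) k
  simpa only [TensorProduct.equivFinsuppOfBasisRight_apply_tmul_apply] using this

/-- For fixed `x`, each coordinate of `m ↦ f (m ⊗ x)` in a basis of `Y` is an equivariant
endomorphism of `M`, hence a scalar. -/
theorem LieModule.exists_eq_tmul_of_isIrreducible [IsAlgClosed K] [FiniteDimensional K M]
    [LieModule.IsIrreducible K L M] {X Y : Type*} [AddCommGroup X] [Module K X]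
    [AddCommGroup Y] [Module K Y] (f : M ⊗[K] X →ₗ[K] M ⊗[K] Y)
    (hf : ∀ (x : L) z, f ((LieModule.toEnd K L M x).rTensor X z) =
      (LieModule.toEnd K L M x).rTensor Y (f z)) :
    ∃ φ : X →ₗ[K] Y, ∀ m x, f (m ⊗ₜ x) = m ⊗ₜ φ x := by
  classical
  have : Nontrivial M := LieModule.nontrivial_of_isIrreducible K L M
  obtain ⟨m₀, hm₀⟩ := exists_ne (0 : M)
  obtain ⟨ℓ, hℓ⟩ := Module.Projective.exists_dual_ne_zero K hm₀
  let b := Module.Basis.ofVectorSpace K Y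
  let e := TensorProduct.equivFinsuppOfBasisRight (M := M) b
  have hc : ∀ x k, ∃ c : K, ∀ m, e (f (m ⊗ₜ x)) k = c • m := fun x k => by
    refine LieModule.exists_eq_smul_of_isIrreducible (L := L)
      (Finsupp.lapply k ∘ₗ e.toLinearMap ∘ₗ f ∘ₗ (TensorProduct.mk K M X).flip x) fun y m => ?_
    have h := hf y (m ⊗ₜ x)
    rw [LinearMap.rTensor_tmul] at h
    change e (f ((LieModule.toEnd K L M y m) ⊗ₜ x)) k = LieModule.toEnd K L M y (e (f (m ⊗ₜ x)) k)
    rw [h]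
    exact TensorProduct.equivFinsuppOfBasisRight_rTensor b _ _ k
  -- Contracting `f (m₀ ⊗ x) = m₀ ⊗ φ x` with `ℓ` and dividing by `ℓ m₀` recovers `φ`, in a form
  -- that is visibly linear.
  let φ : X →ₗ[K] Y := (ℓ m₀)⁻¹ • ((TensorProduct.lid K Y).toLinearMap ∘ₗ ℓ.rTensor Y ∘ₗ f ∘ₗ
    TensorProduct.mk K M X m₀)
  have hφ : ∀ x k, b.repr (φ x) k = (ℓ m₀)⁻¹ * ℓ (e (f (m₀ ⊗ₜ x)) k) := fun x k => by
    have : ∀ z : M ⊗[K] Y, b.repr (TensorProduct.lid K Y (ℓ.rTensor Y z)) k = ℓ (e z k) := by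
      intro z
      induction z with
      | zero => simp
      | tmul m y => simp [e, mul_comm]
      | add z z' hz hz' => simp [map_add, hz, hz']
    simp only [φ, LinearMap.smul_apply, map_smul, Finsupp.smul_apply, smul_eq_mul]
    exact congrArg _ (this _)
  refine ⟨φ, fun m x => e.injective (Finsupp.ext fun k => ?_)⟩
  obtain ⟨c, hc⟩ := hc x k
  rw [hc, TensorProduct.equivFinsuppOfBasisRight_apply_tmul_apply, hφ, hc, map_smul, smul_eq_mul,
    mul_comm c, inv_mul_cancel_left₀ hℓ]

/-- The vectors `m` with `ψ (a ⊗ m) = 0` for all `a` form a submodule of `M`, which is zero since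
`M` is irreducible and `ψ ≠ 0`. The coordinates of `z` in a basis of `X` lie in it. -/
theorem LieModule.eq_zero_of_rTensor_mk_eq_zero [LieModule.IsIrreducible K L M]
    {I N X : Type*} [AddCommGroup I] [Module K I] [LieRingModule L I] [LieModule K L I]
    [AddCommGroup N] [Module K N] [LieRingModule L N] [LieModule K L N]
    [AddCommGroup X] [Module K X]
    (ψ : I ⊗[K] M →ₗ⁅K, L⁆ N) (hψ : ψ ≠ 0) (z : M ⊗[K] X)
    (hz : ∀ a : I, ((ψ : I ⊗[K] M →ₗ[K] N) ∘ₗ TensorProduct.mk K I M a).rTensor X z = 0) :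
    z = 0 := by
  classical
  let S : LieSubmodule K L M :=
    { carrier := {m | ∀ a : I, ψ (a ⊗ₜ m) = 0}
      add_mem' := fun hm hm' a => by
        rw [TensorProduct.tmul_add, map_add, hm a, hm' a, add_zero]
      zero_mem' := fun a => by rw [TensorProduct.tmul_zero, map_zero]
      smul_mem' := fun c m hm a => by rw [TensorProduct.tmul_smul, map_smul, hm a, smul_zero]
      lie_mem := fun {x m} hm a => by
        have h := LieModuleHom.map_lie ψ x (a ⊗ₜ m)
        rw [hm a, lie_zero, TensorProduct.LieModule.lie_tmul_right, map_add, hm, zero_add] at h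
        exact h }
  have hS : S = ⊥ := by
    by_contra h
    have hS := (eq_bot_or_eq_top S).resolve_left h
    refine hψ (LieModuleHom.ext fun p => ?_)
    induction p with
    | zero => exact map_zero ψ
    | tmul a m =>
      have hm : m ∈ S := by rw [hS]; trivial
      exact hm a
    | add p q hp hq => simp [map_add, hp, hq]
  let b := Module.Basis.ofVectorSpace K X
  refine (TensorProduct.equivFinsuppOfBasisRight b).injective (Finsupp.ext fun k => ?_)
  have hk : TensorProduct.equivFinsuppOfBasisRight b z k ∈ S := fun a => by
    have h := TensorProduct.equivFinsuppOfBasisRight_rTensor b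
      ((ψ : I ⊗[K] M →ₗ[K] N) ∘ₗ TensorProduct.mk K I M a) z k
    rw [hz a, map_zero] at h
    exact h.symm
  rw [hS] at hk
  rw [map_zero]
  exact (LieSubmodule.mem_bot _).1 hk

end Schur

/-! ### Products of tensor products -/

section TensorPi

variable (K : Type*) [Field K] {J : Type*} (S : J → Type*) [∀ j, AddCommGroup (S j)]
  [∀ j, Module K (S j)]

/-- The map `∏ S j ⊗ X → ∏ S j ⊗ Y` induced by `h : X → Y`. -/
def tensorPiMap {X Y : Type*} [AddCommGroup X] [Module K X] [AddCommGroup Y] [Module K Y]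
    (h : X →ₗ[K] Y) : (∀ j, S j ⊗[K] X) →ₗ[K] (∀ j, S j ⊗[K] Y) :=
  LinearMap.pi fun j => h.lTensor (S j) ∘ₗ LinearMap.proj j

variable {K} {X Y Z : Type*} [AddCommGroup X] [Module K X] [AddCommGroup Y] [Module K Y]
  [AddCommGroup Z] [Module K Z]

@[simp] theorem tensorPiMap_apply (h : X →ₗ[K] Y) (z : ∀ j, S j ⊗[K] X) (j : J) :
    tensorPiMap K S h z j = h.lTensor (S j) (z j) := rfl

theorem tensorPiMap_injective {h : X →ₗ[K] Y} (hh : Function.Injective h) :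
    Function.Injective (tensorPiMap K S h) := fun _ _ hz => funext fun j =>
  Module.Flat.lTensor_preserves_injective_linearMap h hh (congrFun hz j)

theorem tensorPiMap_surjective {h : X →ₗ[K] Y} (hh : Function.Surjective h) :
    Function.Surjective (tensorPiMap K S h) := fun z => by
  choose y hy using fun j => LinearMap.lTensor_surjective (S j) hh (z j)
  exact ⟨y, funext hy⟩

theorem tensorPiMap_exact {h : X →ₗ[K] Y} {h' : Y →ₗ[K] Z} (hh : Function.Exact h h')
    (hs : Function.Surjective h') :
    Function.Exact (tensorPiMap K S h) (tensorPiMap K S h') := fun z => by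
  have e := fun j => lTensor_exact (S j) hh hs (z j)
  constructor
  · intro hz
    choose y hy using fun j => (e j).1 (congrFun hz j)
    exact ⟨y, funext hy⟩
  · rintro ⟨y, rfl⟩
    exact funext fun j => (e j).2 ⟨y j, rfl⟩

variable {L : Type*} [LieRing L] [LieAlgebra K L] [∀ j, LieRingModule L (S j)]
  [∀ j, LieModule K L (S j)]

variable (K L X) in
/-- The action of `L` on `∏ S j ⊗ X`, trivial on `X`. -/
def tensorPiAction : L →ₗ[K] Module.End K (∀ j, S j ⊗[K] X) where
  toFun x := LinearMap.pi fun j => (LieModule.toEnd K L (S j) x).rTensor X ∘ₗ LinearMap.proj j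
  map_add' x y := by ext z j; simp [LinearMap.rTensor_add]
  map_smul' c x := by ext z j; simp [LinearMap.rTensor_smul]

theorem tensorPiAction_apply (x : L) (z : ∀ j, S j ⊗[K] X) (j : J) :
    tensorPiAction K S X L x z j = (LieModule.toEnd K L (S j) x).rTensor X (z j) := rfl

theorem tensorPiAction_lie (x y : L) (z : ∀ j, S j ⊗[K] X) :
    tensorPiAction K S X L ⁅x, y⁆ z = tensorPiAction K S X L x (tensorPiAction K S X L y z) -
      tensorPiAction K S X L y (tensorPiAction K S X L x z) := by
  funext j
  rw [Pi.sub_apply]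
  simp only [tensorPiAction_apply]
  have h : LieModule.toEnd K L (S j) ⁅x, y⁆ =
      LieModule.toEnd K L (S j) x * LieModule.toEnd K L (S j) y -
      LieModule.toEnd K L (S j) y * LieModule.toEnd K L (S j) x := by
    ext m
    exact lie_lie x y m
  rw [h, LinearMap.rTensor_sub, LinearMap.sub_apply, LinearMap.rTensor_mul, LinearMap.rTensor_mul]
  rfl

theorem tensorPiMap_action (h : X →ₗ[K] Y) (x : L) (z : ∀ j, S j ⊗[K] X) :
    tensorPiMap K S h (tensorPiAction K S X L x z) =
      tensorPiAction K S Y L x (tensorPiMap K S h z) := by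
  funext j
  simp only [tensorPiAction_apply, tensorPiMap_apply, ← LinearMap.comp_apply,
    LinearMap.lTensor_comp_rTensor, LinearMap.rTensor_comp_lTensor]

end TensorPi

/-! ### The functor attached to a family of arrows -/

/-- Homomorphisms `π j r` from `I ⊗ M` to submodules `N j`, with coefficient vectors `A j r` over
`B`. -/
structure ArrowData (K L I M B : Type u) [Field K] [LieRing L] [LieAlgebra K L]
    [AddCommGroup I] [Module K I] [LieRingModule L I] [LieModule K L I]
    [AddCommGroup M] [Module K M] [LieRingModule L M] [LieModule K L M] where
  σ : Type u
  J : Type u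
  R : Type
  [finσ : Fintype σ]
  [finJ : Fintype J]
  [finR : Fintype R]
  N : J → LieSubmodule K L (I ⊗[K] M)
  π : ∀ j, R → (I ⊗[K] M) →ₗ⁅K, L⁆ N j
  A : J → R → σ → B

namespace ArrowData

attribute [instance] finσ finJ finR

variable {K L I M B : Type u} [Field K] [LieRing L] [LieAlgebra K L]
    [AddCommGroup I] [Module K I] [LieRingModule L I] [LieModule K L I]
    [AddCommGroup M] [Module K M] [LieRingModule L M] [LieModule K L M]
    [Ring B] [Algebra K B] (D : ArrowData K L I M B)

section Modules

variable (X : Type u) [AddCommGroup X] [Module K X] [Module B X] [IsScalarTower K B X]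

/-- The map `(I ⊗ M) ⊗ X^σ → ∏ N j ⊗ X` determined by the arrows. -/
def arrowMap : (D.σ → (I ⊗[K] M) ⊗[K] X) →ₗ[K] (∀ j, D.N j ⊗[K] X) :=
  LinearMap.pi fun j => ∑ r, ∑ s,
    TensorProduct.map (D.π j r : I ⊗[K] M →ₗ[K] D.N j) (Algebra.lsmul K K X (D.A j r s)) ∘ₗ
      LinearMap.proj s

/-- The value of `arrowMap` on a pure tensor. -/
def arrow (p : I ⊗[K] M) (w : D.σ → X) : ∀ j, D.N j ⊗[K] X :=
  fun j => ∑ r, D.π j r p ⊗ₜ ∑ s, D.A j r s • w s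

theorem arrowMap_tmul (p : I ⊗[K] M) (w : D.σ → X) :
    D.arrowMap X (fun s => p ⊗ₜ w s) = D.arrow X p w := by
  funext j
  simp [arrowMap, arrow, TensorProduct.tmul_sum]

theorem arrowMap_add_tmul (p q : I ⊗[K] M) (w : D.σ → X) :
    D.arrowMap X (fun s => (p + q) ⊗ₜ w s) =
      D.arrowMap X (fun s => p ⊗ₜ w s) + D.arrowMap X (fun s => q ⊗ₜ w s) := by
  rw [← map_add]
  simp only [TensorProduct.add_tmul]
  rfl

/-- The action of `I`. -/
def theta : I →ₗ[K] (D.σ → M ⊗[K] X) →ₗ[K] (∀ j, D.N j ⊗[K] X) where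
  toFun a := D.arrowMap X ∘ₗ LinearMap.pi fun s =>
    (TensorProduct.mk K I M a).rTensor X ∘ₗ LinearMap.proj s
  map_add' a b := by
    rw [← LinearMap.comp_add]
    congr 1
    ext z s
    simp [LinearMap.rTensor_add]
  map_smul' c a := by
    rw [RingHom.id_apply, ← LinearMap.comp_smul]
    congr 1
    ext z s
    simp [LinearMap.rTensor_smul]

theorem theta_apply (a : I) (z : D.σ → M ⊗[K] X) :
    D.theta X a z = D.arrowMap X (fun s => (TensorProduct.mk K I M a).rTensor X (z s)) := rfl

theorem theta_tmul (a : I) (m : M) (w : D.σ → X) :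
    D.theta X a (fun s => m ⊗ₜ w s) = D.arrow X (a ⊗ₜ m) w := by
  rw [theta_apply, ← arrowMap_tmul]
  rfl

end Modules

/-- Families with a common first factor `m` suffice, because taking `w` supported at one index
already yields a spanning set. -/
theorem hom_ext_tmul {σ M X W : Type*} [Finite σ] [AddCommGroup M] [Module K M] [AddCommGroup X]
    [Module K X] [AddCommGroup W] [Module K W] {f g : (σ → M ⊗[K] X) →ₗ[K] W}
    (h : ∀ m (w : σ → X), f (fun s => m ⊗ₜ w s) = g (fun s => m ⊗ₜ w s)) : f = g := by
  classical
  refine LinearMap.pi_ext' fun s => TensorProduct.ext' fun m x => ?_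
  have := h m (Pi.single s x)
  have e : (fun t => m ⊗ₜ[K] (Pi.single s x : σ → X) t) = Pi.single s (m ⊗ₜ[K] x) := by
    funext t
    rcases eq_or_ne t s with rfl | ht
    · simp
    · simp [ht]
  rw [e] at this
  exact this

/-- Schur's lemma with coefficients, applied to each block of the matrix of `f`. -/
theorem exists_eq_tmul_of_forall_action {σ X Y : Type*} [Finite σ] [IsAlgClosed K]
    [FiniteDimensional K M] [LieModule.IsIrreducible K L M] [AddCommGroup X] [Module K X]
    [AddCommGroup Y] [Module K Y] {f : (σ → M ⊗[K] X) →ₗ[K] (σ → M ⊗[K] Y)}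
    (hf : ∀ (x : L) z, f (tensorPiAction K (fun _ : σ => M) X L x z) =
      tensorPiAction K (fun _ : σ => M) Y L x (f z)) :
    ∃ Φ : (σ → X) →ₗ[K] (σ → Y), ∀ m w, f (fun s => m ⊗ₜ w s) = fun s => m ⊗ₜ Φ w s := by
  classical
  have := Fintype.ofFinite σ
  have hφ : ∀ s t, ∃ φ : X →ₗ[K] Y, ∀ m x, f (Pi.single s (m ⊗ₜ x)) t = m ⊗ₜ φ x := fun s t =>
    LieModule.exists_eq_tmul_of_isIrreducible (L := L)
      (LinearMap.proj t ∘ₗ f ∘ₗ LinearMap.single K (fun _ : σ => M ⊗[K] X) s) fun x z => by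
      refine Eq.trans (congrArg (fun z => f z t) ?_) (congrFun (hf x (Pi.single s z)) t)
      funext i
      rw [tensorPiAction_apply, LinearMap.coe_single]
      rcases eq_or_ne i s with rfl | hi
      · rw [Pi.single_eq_same, Pi.single_eq_same]
      · rw [Pi.single_eq_of_ne hi, Pi.single_eq_of_ne hi, map_zero]
  choose φ hφ using hφ
  refine ⟨LinearMap.pi fun t => ∑ s, φ s t ∘ₗ LinearMap.proj s, fun m w => ?_⟩
  rw [show (fun s => m ⊗ₜ[K] w s) = ∑ s, Pi.single s (m ⊗ₜ w s) from
    (Finset.univ_sum_single _).symm, map_sum]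
  funext t
  rw [Finset.sum_apply]
  simp only [hφ, LinearMap.pi_apply, LinearMap.sum_apply, TensorProduct.tmul_sum,
    LinearMap.comp_apply, LinearMap.proj_apply]

/-! ### The representation attached to a `B`-module, and its functoriality -/

section Functor

variable (X : Type u) [AddCommGroup X] [Module K X] [Module B X] [IsScalarTower K B X]
  {Y : Type u} [AddCommGroup Y] [Module K Y] [Module B Y] [IsScalarTower K B Y]

theorem theta_equivariant (x : L) (a : I) (z : D.σ → M ⊗[K] X) :
    tensorPiAction K (fun j => D.N j) X L x (D.theta X a z) =
      D.theta X ⁅x, a⁆ z + D.theta X a (tensorPiAction K (fun _ : D.σ => M) X L x z) := by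
  suffices h : tensorPiAction K (fun j => D.N j) X L x ∘ₗ D.theta X a =
      D.theta X ⁅x, a⁆ + D.theta X a ∘ₗ tensorPiAction K (fun _ : D.σ => M) X L x from
    LinearMap.congr_fun h z
  refine hom_ext_tmul fun m w => ?_
  have e : tensorPiAction K (fun _ : D.σ => M) X L x (fun s => m ⊗ₜ w s) =
    fun s => ⁅x, m⁆ ⊗ₜ w s := rfl
  rw [LinearMap.add_apply, LinearMap.comp_apply, LinearMap.comp_apply, e, theta_tmul, theta_tmul,
    theta_tmul]
  funext j
  rw [tensorPiAction_apply, Pi.add_apply]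
  simp only [arrow]
  rw [map_sum, ← Finset.sum_add_distrib]
  refine Finset.sum_congr rfl fun r _ => ?_
  rw [LinearMap.rTensor_tmul, ← TensorProduct.add_tmul, ← map_add,
    ← TensorProduct.LieModule.lie_tmul_right, LieModuleHom.map_lie]
  rfl

variable {X} in
-- The coefficients of the arrows lie in `B`, so they commute with the `B`-linear `h`.
theorem tensorPiMap_theta (h : X →ₗ[B] Y) (a : I) (z : D.σ → M ⊗[K] X) :
    tensorPiMap K (fun j => D.N j) (h.restrictScalars K) (D.theta X a z) =
      D.theta Y a (tensorPiMap K (fun _ : D.σ => M) (h.restrictScalars K) z) := by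
  suffices h : tensorPiMap K (fun j => D.N j) (h.restrictScalars K) ∘ₗ D.theta X a =
      D.theta Y a ∘ₗ tensorPiMap K (fun _ : D.σ => M) (h.restrictScalars K) from
    LinearMap.congr_fun h z
  refine hom_ext_tmul fun m w => ?_
  have e : tensorPiMap K (fun _ : D.σ => M) (h.restrictScalars K) (fun s => m ⊗ₜ w s) =
    fun s => m ⊗ₜ h (w s) := rfl
  rw [LinearMap.comp_apply, LinearMap.comp_apply, e, theta_tmul, theta_tmul]
  funext j
  simp [arrow]

variable [FiniteDimensional K I] [FiniteDimensional K M]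

/-- The representation attached to a `B`-module. -/
def rep [FiniteDimensional K X] : TwoStepRep K L I where
  V₀ := D.σ → M ⊗[K] X
  V₁ := ∀ j, D.N j ⊗[K] X
  ρ₀ := tensorPiAction K (fun _ : D.σ => M) X L
  ρ₁ := tensorPiAction K (fun j => D.N j) X L
  map_lie₀ := tensorPiAction_lie _
  map_lie₁ := tensorPiAction_lie _
  Θ := D.theta X
  equivariant := D.theta_equivariant X

variable {X} in
/-- The morphism attached to a homomorphism of `B`-modules. -/
def repMap [FiniteDimensional K X] [FiniteDimensional K Y] (h : X →ₗ[B] Y) :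
    (D.rep X).toRep ⟶ (D.rep Y).toRep :=
  TwoStepRep.homMk (D := D.rep X) (D' := D.rep Y)
    (tensorPiMap K (fun _ : D.σ => M) (h.restrictScalars K))
    (tensorPiMap K (fun j => D.N j) (h.restrictScalars K)) 0
    (tensorPiMap_action _ _) (tensorPiMap_action _ _) (fun _ _ => by simp)
    (D.tensorPiMap_theta h)

variable {X} in
theorem lin_repMap [FiniteDimensional K X] [FiniteDimensional K Y] (h : X →ₗ[B] Y)
    (v : (D.rep X).V₀ × (D.rep X).V₁) :
    TwoStepRep.lin (D.repMap h) v =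
      ((tensorPiMap K (fun _ : D.σ => M) (h.restrictScalars K) v.1,
        tensorPiMap K (fun j => D.N j) (h.restrictScalars K) v.2) :
          (D.σ → M ⊗[K] Y) × (∀ j, D.N j ⊗[K] Y)) := by
  refine Prod.ext rfl ?_
  exact zero_add (tensorPiMap K (fun j => D.N j) (h.restrictScalars K) v.2)

variable {X} in
theorem repMap_id [FiniteDimensional K X] :
    D.repMap (LinearMap.id : X →ₗ[B] X) = 𝟙 (D.rep X).toRep :=
  TwoStepRep.hom_ext fun v => by
    rw [lin_repMap]
    refine Prod.ext (funext fun s => ?_) (funext fun s => ?_)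
    · exact LinearMap.congr_fun (LinearMap.lTensor_id M X) (v.1 s)
    · exact LinearMap.congr_fun (LinearMap.lTensor_id (D.N s) X) (v.2 s)

variable {X} in
theorem repMap_comp {Z : Type u} [AddCommGroup Z] [Module K Z] [Module B Z] [IsScalarTower K B Z]
    [FiniteDimensional K X] [FiniteDimensional K Y] [FiniteDimensional K Z]
    (h : X →ₗ[B] Y) (h' : Y →ₗ[B] Z) : D.repMap (h' ∘ₗ h) = D.repMap h ≫ D.repMap h' :=
  TwoStepRep.hom_ext fun v => by
    rw [lin_repMap, TwoStepRep.lin_comp, lin_repMap, lin_repMap]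
    refine Prod.ext (funext fun s => ?_) (funext fun s => ?_)
    · exact LinearMap.lTensor_comp_apply M (h'.restrictScalars K) (h.restrictScalars K) (v.1 s)
    · exact LinearMap.lTensor_comp_apply (D.N s) (h'.restrictScalars K) (h.restrictScalars K)
        (v.2 s)

variable {X} in
theorem repMap_add [FiniteDimensional K X] [FiniteDimensional K Y] (h h' : X →ₗ[B] Y) :
    D.repMap (h + h') = D.repMap h + D.repMap h' :=
  TwoStepRep.hom_ext fun v => by
    rw [TwoStepRep.lin_add, lin_repMap, lin_repMap, lin_repMap]
    refine Prod.ext (funext fun s => ?_) (funext fun s => ?_)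
    · exact LinearMap.congr_fun (LinearMap.lTensor_add M (h.restrictScalars K)
        (h'.restrictScalars K)) (v.1 s)
    · exact LinearMap.congr_fun (LinearMap.lTensor_add (D.N s) (h.restrictScalars K)
        (h'.restrictScalars K)) (v.2 s)

variable {X} in
theorem repMap_smul [FiniteDimensional K X] [FiniteDimensional K Y] (c : K) (h h' : X →ₗ[B] Y)
    (hh : ∀ x, h' x = c • h x) : D.repMap h' = c • D.repMap h :=
  TwoStepRep.hom_ext fun v => by
    have e : h'.restrictScalars K = c • h.restrictScalars K := LinearMap.ext hh
    rw [TwoStepRep.lin_smul, lin_repMap, lin_repMap, e]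
    refine Prod.ext (funext fun s => ?_) (funext fun s => ?_)
    · exact LinearMap.congr_fun (LinearMap.lTensor_smul M c (h.restrictScalars K)) (v.1 s)
    · exact LinearMap.congr_fun (LinearMap.lTensor_smul (D.N s) c (h.restrictScalars K)) (v.2 s)

end Functor

/-- The hypotheses on the arrows under which the functor is a controlled embedding. -/
structure IsWild : Prop where
  exists_proj : ∀ s, ∃ (j : D.J) (ψ : (I ⊗[K] M) →ₗ⁅K, L⁆ D.N j), ψ ≠ 0 ∧
    ∀ (X : Type u) [AddCommGroup X] [Module K X] [Module B X] [IsScalarTower K B X]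
      (p : I ⊗[K] M) (w : D.σ → X), D.arrow X p w j = ψ p ⊗ₜ w s
  exists_arrow : ∀ (X : Type u) [AddCommGroup X] [Module K X] [Module B X] [IsScalarTower K B X]
    (j : D.J) (n : D.N j) (x : X), ∃ p w, D.arrow X p w j = n ⊗ₜ x ∧
      ∀ i, i ≠ j → D.arrow X p w i = 0
  full : ∀ (X Y : Type u) [AddCommGroup X] [Module K X] [Module B X] [IsScalarTower K B X]
    [AddCommGroup Y] [Module K Y] [Module B Y] [IsScalarTower K B Y]
    (φ : (D.σ → X) →ₗ[K] (D.σ → Y)) (g : (∀ j, D.N j ⊗[K] X) →ₗ[K] (∀ j, D.N j ⊗[K] Y)),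
    (∀ p w, g (D.arrow X p w) = D.arrow Y p (φ w)) → ∃ h : X →ₗ[B] Y, ∀ w s, φ w s = h (w s)
  nonempty : Nonempty D.σ

variable {D}

/-! ### Morphisms between the representations of a wild family of arrows -/

section Wild

variable [FiniteDimensional K I] [FiniteDimensional K M]
  (X : Type u) [AddCommGroup X] [Module K X] [Module B X] [IsScalarTower K B X]
  [FiniteDimensional K X]
  {Y : Type u} [AddCommGroup Y] [Module K Y] [Module B Y] [IsScalarTower K B Y]

/-- By `exists_proj`, some coordinate of the action of `I` sees only the entry `z s`, through a
nonzero map `ψ`; irreducibility of `M` then forces `z s = 0`. -/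
theorem IsWild.isFaithfulOnTop [LieModule.IsIrreducible K L M] (hD : D.IsWild) :
    (D.rep X).IsFaithfulOnTop := by
  intro z hz
  refine funext fun s => ?_
  obtain ⟨j, ψ, hψ, h⟩ := hD.exists_proj s
  refine LieModule.eq_zero_of_rTensor_mk_eq_zero ψ hψ (z s) fun a => ?_
  change D.σ → M ⊗[K] X at z
  have e : LinearMap.proj j ∘ₗ D.arrowMap X =
      (ψ : I ⊗[K] M →ₗ[K] D.N j).rTensor X ∘ₗ LinearMap.proj s := by
    refine hom_ext_tmul fun p w => ?_
    rw [LinearMap.comp_apply, arrowMap_tmul]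
    exact h X p w
  have := LinearMap.congr_fun e (fun s => (TensorProduct.mk K I M a).rTensor X (z s))
  rw [LinearMap.rTensor_comp]
  exact this.symm.trans (congrFun (hz a) j)

/-- By `exists_arrow`, each pure tensor in a single factor of `V₁` is a value of `arrow`, and these
values are sums of images under elements of `I`. -/
theorem IsWild.isGenerated (hD : D.IsWild) : (D.rep X).IsGenerated := by
  classical
  refine eq_top_iff.2 fun z _ => ?_
  have key : ∀ p w, D.arrow X p w ∈
      Submodule.span K {w : (D.rep X).V₁ | ∃ a v, w = (D.rep X).Θ a v} := fun p w => by
    rw [← arrowMap_tmul]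
    induction p with
    | zero => simp only [TensorProduct.zero_tmul]; exact (D.arrowMap X).map_zero ▸ zero_mem _
    | tmul a m =>
      rw [arrowMap_tmul]
      exact Submodule.subset_span ⟨a, fun s => m ⊗ₜ w s, (D.theta_tmul X a m w).symm⟩
    | add p q hp hq =>
      rw [arrowMap_add_tmul]
      exact add_mem hp hq
  change (∀ j, D.N j ⊗[K] X) at z
  rw [← Finset.univ_sum_single z]
  refine Submodule.sum_mem _ fun j _ => ?_
  generalize z j = y
  induction y with
  | zero => rw [Pi.single_zero]; exact zero_mem _
  | tmul n x =>
    obtain ⟨p, w, h, h'⟩ := hD.exists_arrow X j n x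
    have e : Pi.single j (n ⊗ₜ[K] x) = D.arrow X p w := ?_
    · rw [e]; exact key p w
    funext i
    rcases eq_or_ne i j with rfl | hi
    · rw [Pi.single_eq_same, h]
    · rw [Pi.single_eq_of_ne hi, h' i hi]
  | add y y' hy hy' => rw [Pi.single_add]; exact add_mem hy hy'

variable {X}

/-- Schur's lemma reduces `f₀` to a map `Φ` on `X^σ`, and `full` makes `Φ` a diagonal copy of some
`h`. Then `f₁` is determined by `f₀`, because the image of `I` generates `V₁`. -/
theorem IsWild.exists_eq_tensorPiMap [IsAlgClosed K] [LieModule.IsIrreducible K L M] (hD : D.IsWild)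
    (f₀ : (D.σ → M ⊗[K] X) →ₗ[K] (D.σ → M ⊗[K] Y))
    (h₀ : ∀ (x : L) z, f₀ (tensorPiAction K (fun _ : D.σ => M) X L x z) =
      tensorPiAction K (fun _ : D.σ => M) Y L x (f₀ z))
    (f₁ : (∀ j, D.N j ⊗[K] X) →ₗ[K] (∀ j, D.N j ⊗[K] Y))
    (hΘ : ∀ a z, f₁ (D.theta X a z) = D.theta Y a (f₀ z)) :
    ∃ h : X →ₗ[B] Y, f₀ = tensorPiMap K (fun _ : D.σ => M) (h.restrictScalars K) ∧
      f₁ = tensorPiMap K (fun j => D.N j) (h.restrictScalars K) := by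
  obtain ⟨Φ, hΦ⟩ := exists_eq_tmul_of_forall_action h₀
  have hg : ∀ p w, f₁ (D.arrow X p w) = D.arrow Y p (Φ w) := fun p w => by
    rw [← arrowMap_tmul, ← arrowMap_tmul]
    induction p with
    | zero =>
      simp only [TensorProduct.zero_tmul]
      exact (congrArg f₁ (D.arrowMap X).map_zero).trans (f₁.map_zero.trans
        (D.arrowMap Y).map_zero.symm)
    | tmul a m =>
      rw [arrowMap_tmul, arrowMap_tmul, ← theta_tmul, ← theta_tmul, ← hΦ]
      exact hΘ a _
    | add p q hp hq =>
      rw [D.arrowMap_add_tmul, D.arrowMap_add_tmul, map_add, hp, hq]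
  obtain ⟨h, hh⟩ := hD.full X Y Φ f₁ hg
  have e₀ : f₀ = tensorPiMap K (fun _ : D.σ => M) (h.restrictScalars K) :=
    hom_ext_tmul fun m w => by
      rw [hΦ]
      funext s
      rw [hh]
      rfl
  refine ⟨h, e₀, LinearMap.ext_on (hD.isGenerated X) ?_⟩
  rintro _ ⟨a, v, rfl⟩
  refine (hΘ a v).trans ?_
  rw [e₀]
  exact (D.tensorPiMap_theta h a v).symm

theorem IsWild.exists_eq_repMap [IsAlgClosed K] [LieModule.IsIrreducible K L M]
    [FiniteDimensional K Y] (hD : D.IsWild)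
    (f : (D.rep X).toRep ⟶ (D.rep Y).toRep) :
    ∃ (h : X →ₗ[B] Y) (c : (D.rep X).toRep ⟶ (D.rep Y).toRep),
      FactorsThroughClass (trivialOnIdeal K L I) c ∧ f = D.repMap h + c := by
  obtain ⟨f₀, f₁, h₀, h₁, hΘ, c, hc, rfl⟩ :=
    TwoStepRep.exists_homMk_add (hD.isFaithfulOnTop Y) f
  obtain ⟨h, e₀, e₁⟩ := hD.exists_eq_tensorPiMap f₀ h₀ f₁ hΘ
  subst e₀ e₁
  exact ⟨h, c, hc, rfl⟩

/-- `D.repMap h` is block diagonal, whereas a morphism through the class has zero diagonal blocks.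
-/
theorem IsWild.repMap_eq_zero [LieModule.IsIrreducible K L M] [FiniteDimensional K Y]
    (hD : D.IsWild) (h : X →ₗ[B] Y)
    (hc : FactorsThroughClass (trivialOnIdeal K L I) (D.repMap h)) : D.repMap h = 0 := by
  obtain ⟨h₁, h₂⟩ := TwoStepRep.factorsThrough_trivialOnIdeal (hD.isGenerated X)
    (hD.isFaithfulOnTop Y) hc
  refine TwoStepRep.hom_ext fun v => ?_
  refine Prod.ext (h₂ v) ?_
  have e := congrArg Prod.snd (h₁ v.2)
  rw [lin_repMap] at e ⊢
  exact e

theorem IsWild.repMap_injective [LieModule.IsIrreducible K L M] [FiniteDimensional K Y]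
    (hD : D.IsWild) (h h' : X →ₗ[B] Y) (e : D.repMap h = D.repMap h') : h = h' := by
  have : Nontrivial M := LieModule.nontrivial_of_isIrreducible K L M
  obtain ⟨m, hm⟩ := exists_ne (0 : M)
  obtain ⟨s⟩ := hD.nonempty
  refine LinearMap.ext fun x => ?_
  have e' := congrArg (fun f => (TwoStepRep.lin f ((fun _ => m ⊗ₜ x, 0) :
    (D.σ → M ⊗[K] X) × (∀ j, D.N j ⊗[K] X))).1) e
  have e'' : m ⊗ₜ[K] h x = m ⊗ₜ[K] h' x := congrFun e' s
  exact TensorProduct.tmul_right_injective_of_ne_zero hm e''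

end Wild

/-! ### The functor and its control by the class -/

section Category

variable (D) [FiniteDimensional K I] [FiniteDimensional K M]

instance finiteDimensional_obj (X : FinDimMod K B) : FiniteDimensional K X.obj := X.property

/-- The functor `X ↦ M^σ ⊗ X ⊕ ⨁ N j ⊗ X`. -/
def functor : FinDimMod K B ⥤ FinDimLieRep K (SemidirectModule K L I) where
  obj X := (D.rep X.obj).toRep
  map h := D.repMap h.hom.hom
  map_id _ := D.repMap_id
  map_comp h h' := D.repMap_comp h.hom.hom h'.hom.hom

instance : D.functor.Additive where
  map_add {_ _ h h'} := D.repMap_add h.hom.hom h'.hom.hom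

instance : D.functor.Linear K where
  map_smul {_ _} h c := D.repMap_smul c h.hom.hom _ fun _ => rfl

theorem preservesShortExact_functor : PreservesShortExact D.functor := by
  intro X Y Z i p hi hip hp
  have e : ∀ (X Y : FinDimMod K B) (h : X ⟶ Y),
      (FinDimLieRep.toHom (D.functor.map h) : (D.functor.obj X).carrier → (D.functor.obj Y).carrier) =
      (Prod.map (tensorPiMap K (fun _ : D.σ => M) (h.hom.hom.restrictScalars K))
        (tensorPiMap K (fun j => D.N j) (h.hom.hom.restrictScalars K)) :
        (D.σ → M ⊗[K] X.obj) × (∀ j, D.N j ⊗[K] X.obj) →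
        (D.σ → M ⊗[K] Y.obj) × (∀ j, D.N j ⊗[K] Y.obj)) :=
    fun X Y h => funext fun v => D.lin_repMap h.hom.hom v
  refine ⟨?_, ?_, ?_⟩
  · rw [e]
    exact (tensorPiMap_injective _ hi).prodMap (tensorPiMap_injective _ hi)
  · rw [e, e]
    rintro ⟨y, z⟩
    have h₁ := tensorPiMap_exact (h := i.hom.hom.restrictScalars K)
      (h' := p.hom.hom.restrictScalars K) (fun _ : D.σ => M) hip hp y
    have h₂ := tensorPiMap_exact (h := i.hom.hom.restrictScalars K)
      (h' := p.hom.hom.restrictScalars K) (fun j => D.N j) hip hp z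
    constructor
    · intro h
      obtain ⟨y', hy⟩ := h₁.1 (congrArg Prod.fst h)
      obtain ⟨z', hz⟩ := h₂.1 (congrArg Prod.snd h)
      exact ⟨(y', z'), Prod.ext hy hz⟩
    · rintro ⟨⟨y', z'⟩, h⟩
      exact Prod.ext (h₁.2 ⟨y', congrArg Prod.fst h⟩) (h₂.2 ⟨z', congrArg Prod.snd h⟩)
  · rw [e]
    exact (tensorPiMap_surjective _ hp).prodMap (tensorPiMap_surjective _ hp)

variable {D}

theorem IsWild.exists_functor [IsAlgClosed K] [LieModule.IsIrreducible K L M] (hD : D.IsWild) :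
    ∃ (F : FinDimMod K B ⥤ FinDimLieRep K (SemidirectModule K L I)) (_ : F.Additive)
      (C : ObjectProperty (FinDimLieRep K (SemidirectModule K L I))),
      F.Linear K ∧ F.Faithful ∧ PreservesShortExact F ∧
      IsClosedUnderSumsAndSummands C ∧ IsControlledBy F C := by
  refine ⟨D.functor, inferInstance, trivialOnIdeal K L I, inferInstance, ⟨?_⟩,
    D.preservesShortExact_functor, isClosedUnderSumsAndSummands_trivialOnIdeal K L I, ?_, ?_, ?_⟩
  · intro X Y h h' e
    exact ObjectProperty.hom_ext _ (ModuleCat.hom_ext (hD.repMap_injective _ _ e))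
  · intro X Y f
    obtain ⟨h, c, hc, e⟩ := hD.exists_eq_repMap f
    exact ⟨ObjectProperty.homMk (ModuleCat.ofHom h), c, hc, e⟩
  · intro X Y h hc
    exact hD.repMap_eq_zero _ hc
  · intro X Y c hc
    exact TwoStepRep.isRadicalMorphism_of_factorsThrough (hD.isGenerated _)
      (hD.isFaithfulOnTop _) (hD.isFaithfulOnTop _) hc

end Category

end ArrowData

/-! ### A rigid configuration of subspaces over a finitely generated algebra -/

/-- A linear map `φ : X^σ → Y^σ` commutes with a diagonal matrix with distinct entries and
preserves the subspace of all `(u, v, u + b γ v)`. If the `b γ` generate `B`, then `φ` is induced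
by a homomorphism of `B`-modules. -/
theorem exists_eq_of_preserves {K B β X Y : Type*} [Field K] [Ring B] [Algebra K B]
    [AddCommGroup X] [Module K X] [Module B X] [IsScalarTower K B X]
    [AddCommGroup Y] [Module K Y] [Module B Y] [IsScalarTower K B Y] [Finite β]
    {b : β → B} (hb : Algebra.adjoin K (Set.range b) = ⊤) {β₀ : β} (hβ₀ : b β₀ = 1)
    {t : Bool ⊕ β → K} (ht : Function.Injective t)
    (φ : (Bool ⊕ β → X) →ₗ[K] (Bool ⊕ β → Y))
    (hT : ∀ w s, φ (fun s => t s • w s) s = t s • φ w s)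
    (hc : ∀ w : Bool ⊕ β → X,
      (∀ γ, w (.inr γ) = w (.inl false) + b γ • w (.inl true)) →
      ∀ γ, φ w (.inr γ) = φ w (.inl false) + b γ • φ w (.inl true)) :
    ∃ h : X →ₗ[B] Y, ∀ w s, φ w s = h (w s) := by
  classical
  have := Fintype.ofFinite β
  let ψ : ∀ s : Bool ⊕ β, X →ₗ[K] Y := fun s =>
    LinearMap.proj s ∘ₗ φ ∘ₗ LinearMap.single K (fun _ : Bool ⊕ β => X) s
  -- Commuting with a diagonal matrix with distinct entries forces `φ` to be diagonal, with entries
  -- `ψ s`.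
  have hoff : ∀ s s' x, s' ≠ s → φ (Pi.single s x) s' = 0 := fun s s' x hs => by
    have h := hT (Pi.single s x) s'
    have e : (fun i => t i • (Pi.single s x : Bool ⊕ β → X) i) = t s • Pi.single s x := by
      funext i
      rcases eq_or_ne i s with rfl | hi
      · rfl
      · simp [hi]
    rw [e, map_smul, Pi.smul_apply, ← sub_eq_zero, ← sub_smul, smul_eq_zero] at h
    exact h.resolve_left fun h => hs (ht (sub_eq_zero.1 h)).symm
  have hψ : ∀ w s, φ w s = ψ s (w s) := fun w s => by
    conv_lhs => rw [← Finset.univ_sum_single w, map_sum, Finset.sum_apply]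
    exact Finset.sum_eq_single s (fun i _ hi => hoff i s _ hi.symm)
      fun h => absurd (Finset.mem_univ s) h
  -- The vectors with `v = 0` identify the entries at `γ` and at `u`. Those with `u = 0` then give
  -- `ψ (b γ v) = b γ ψ' v`, where `ψ'` is the entry at `v`, and `b β₀ = 1` gives `ψ' = ψ`.
  have h₁ : ∀ γ u, ψ (.inr γ) u = ψ (.inl false) u := fun γ u => by
    have := hc (Sum.elim (fun i => cond i 0 u) fun _ => u) (fun γ => by simp) γ
    simpa [hψ] using this
  have h₂ : ∀ γ v, ψ (.inr γ) (b γ • v) = b γ • ψ (.inl true) v := fun γ v => by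
    have := hc (Sum.elim (fun i => cond i v 0) fun γ => b γ • v) (fun γ => by simp) γ
    simpa [hψ] using this
  have h₃ : ∀ v, ψ (.inl true) v = ψ (.inl false) v := fun v => by
    rw [← h₁ β₀, ← one_smul B (ψ (.inl true) v), ← hβ₀, ← h₂, hβ₀, one_smul]
  have h₄ : ∀ c v, ψ (.inl false) (c • v) = c • ψ (.inl false) v := fun c => by
    have hc : c ∈ Algebra.adjoin K (Set.range b) := by rw [hb]; trivial
    induction hc using Algebra.adjoin_induction with
    | mem c hc =>
      obtain ⟨γ, rfl⟩ := hc
      intro v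
      rw [← h₁ γ, h₂, h₃]
    | algebraMap r => intro v; rw [algebraMap_smul, algebraMap_smul, map_smul]
    | add c d _ _ hc hd => intro v; rw [add_smul, add_smul, map_add, hc, hd]
    | mul c d _ _ hc hd => intro v; rw [mul_smul, mul_smul, hc, hd]
  refine ⟨{ toFun := ψ (.inl false), map_add' := map_add _, map_smul' := h₄ }, fun w s => ?_⟩
  rw [hψ]
  rcases s with (_ | _) | γ
  · rfl
  · exact h₃ _
  · exact h₁ _ _

namespace ArrowData

variable {K L I M B : Type u} [Field K] [LieRing L] [LieAlgebra K L]
    [AddCommGroup I] [Module K I] [LieRingModule L I] [LieModule K L I]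
    [AddCommGroup M] [Module K M] [LieRingModule L M] [LieModule K L M]
    [Ring B] [Algebra K B]

/-- The coefficients of the quotient maps whose common kernel is the subspace of all
`(u, v, u + b γ v)`. -/
def graphCoeff {β : Type*} [DecidableEq β] (b : β → B) (γ : β) : Bool ⊕ β → B :=
  Pi.single (.inr γ) 1 - Pi.single (.inl false) 1 - Pi.single (.inl true) (b γ)

/-! ### A component of multiplicity two together with a third summand -/

section Double

variable {β : Type u} [Fintype β] [DecidableEq β] (N N' : LieSubmodule K L (I ⊗[K] M))
  (π₁ π₂ : (I ⊗[K] M) →ₗ⁅K, L⁆ N) (π₃ : (I ⊗[K] M) →ₗ⁅K, L⁆ N') (b : β → B) (t : Bool ⊕ β → K)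

/-- The arrows for a component of multiplicity two and another component. -/
abbrev double : ArrowData K L I M B where
  σ := Bool ⊕ β
  J := (Bool ⊕ β) ⊕ β
  R := Bool
  N := Sum.elim (fun _ => N) fun _ => N'
  π
    | .inl _ => fun r => cond r π₁ π₂
    | .inr _ => fun r => cond r π₃ 0
  A
    | .inl s => fun r => Pi.single s (cond r 1 (algebraMap K B (t s)))
    | .inr γ => fun _ => graphCoeff b γ

variable {X : Type u} [AddCommGroup X] [Module K X] [Module B X]

theorem sum_single_smul {σ : Type*} [Fintype σ] [DecidableEq σ] (s : σ) (c : B) (w : σ → X) :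
    ∑ i, (Pi.single s c : σ → B) i • w i = c • w s := by
  rw [Finset.sum_eq_single s]
  · rw [Pi.single_eq_same]
  · intro i _ hi
    rw [Pi.single_eq_of_ne hi, zero_smul]
  · intro h
    exact absurd (Finset.mem_univ s) h

theorem sum_graphCoeff_smul (γ : β) (w : Bool ⊕ β → X) :
    ∑ i, graphCoeff b γ i • w i = w (.inr γ) - w (.inl false) - b γ • w (.inl true) := by
  simp only [graphCoeff, Pi.sub_apply, sub_smul, Finset.sum_sub_distrib, sum_single_smul, one_smul]

theorem arrow_double_inl [IsScalarTower K B X] (p : I ⊗[K] M) (w : Bool ⊕ β → X) (s : Bool ⊕ β) :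
    @Eq (N ⊗[K] X) ((double N N' π₁ π₂ π₃ b t).arrow X p w (.inl s))
      (π₁ p ⊗ₜ w s + π₂ p ⊗ₜ (t s • w s)) := by
  change (∑ r : Bool, (cond r π₁ π₂ : (I ⊗[K] M) →ₗ⁅K, L⁆ N) p ⊗ₜ[K]
    ∑ i, (Pi.single s (cond r 1 (algebraMap K B (t s))) : Bool ⊕ β → B) i • w i : N ⊗[K] X) = _
  rw [Fintype.sum_bool]
  simp only [sum_single_smul, cond_true, cond_false, one_smul, algebraMap_smul]

theorem arrow_double_inr (p : I ⊗[K] M) (w : Bool ⊕ β → X) (γ : β) :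
    @Eq (N' ⊗[K] X) ((double N N' π₁ π₂ π₃ b t).arrow X p w (.inr γ))
      (π₃ p ⊗ₜ (w (.inr γ) - w (.inl false) - b γ • w (.inl true))) := by
  change (∑ r : Bool, (cond r π₃ 0 : (I ⊗[K] M) →ₗ⁅K, L⁆ N') p ⊗ₜ[K]
    ∑ i, graphCoeff b γ i • w i : N' ⊗[K] X) = _
  rw [Fintype.sum_bool, sum_graphCoeff_smul]
  simp only [cond_true, cond_false, LieModuleHom.zero_apply, TensorProduct.zero_tmul, add_zero]

variable {N N' π₁ π₂ π₃ b t}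

/-- On the copies of `N` the arrows are `π₁ ⊗ 1 + π₂ ⊗ T` with `T` the diagonal matrix of `t`;
comparing the two summands forces `φ` to commute with `T`. The arrows into the copies of `N'` vanish
together exactly on the subspace of all `(u, v, u + b γ v)`, which `φ` therefore preserves. -/
theorem isWild_double [Nontrivial N] [Nontrivial N']
    (hπ : ∀ n₁ n₂ n₃, ∃ p, π₁ p = n₁ ∧ π₂ p = n₂ ∧ π₃ p = n₃)
    (hb : Algebra.adjoin K (Set.range b) = ⊤) {β₀ : β} (hβ₀ : b β₀ = 1)
    (ht : Function.Injective t) : (double N N' π₁ π₂ π₃ b t).IsWild where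
  exists_proj s := by
    refine ⟨.inl s, π₁ + t s • π₂, fun h => ?_, fun X _ _ _ _ p w => ?_⟩
    · obtain ⟨n, hn⟩ := exists_ne (0 : N)
      obtain ⟨p, h₁, h₂, -⟩ := hπ n 0 0
      have := LieModuleHom.congr_fun h p
      refine hn ?_
      rw [← h₁]
      have e : π₁ p + t s • π₂ p = 0 := this
      rwa [h₂, smul_zero, add_zero] at e
    · change (_ : N ⊗[K] X) = _
      rw [arrow_double_inl, TensorProduct.tmul_smul, TensorProduct.smul_tmul',
        ← TensorProduct.add_tmul]
      rfl
  exists_arrow X _ _ _ _ j n x := by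
    rcases j with s | γ
    · change N at n
      obtain ⟨p, h₁, h₂, h₃⟩ := hπ n 0 0
      refine ⟨p, Pi.single s x, ?_, ?_⟩
      · change (_ : N ⊗[K] X) = n ⊗ₜ x
        rw [arrow_double_inl, h₁, h₂, Pi.single_eq_same, TensorProduct.zero_tmul, add_zero]
      · rintro (s' | γ) hs
        · change _ = (0 : N ⊗[K] X)
          rw [arrow_double_inl, h₂, Pi.single_eq_of_ne (fun h => hs (congrArg _ h)),
            TensorProduct.zero_tmul, TensorProduct.tmul_zero, add_zero]
        · change _ = (0 : N' ⊗[K] X)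
          rw [arrow_double_inr, h₃, TensorProduct.zero_tmul]
    · change N' at n
      obtain ⟨p, h₁, h₂, h₃⟩ := hπ 0 0 n
      refine ⟨p, Pi.single (.inr γ) x, ?_, ?_⟩
      · change (_ : N' ⊗[K] X) = n ⊗ₜ x
        rw [arrow_double_inr, h₃]
        simp
      · rintro (s | γ') hs
        · change _ = (0 : N ⊗[K] X)
          rw [arrow_double_inl, h₁, h₂, TensorProduct.zero_tmul, TensorProduct.zero_tmul, add_zero]
        · have hγ : γ' ≠ γ := fun h => hs (congrArg _ h)
          change _ = (0 : N' ⊗[K] X)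
          rw [arrow_double_inr]
          simp [hγ]
  full X Y _ _ _ _ _ _ _ _ φ g hg := by
    obtain ⟨n, hn⟩ := exists_ne (0 : N)
    obtain ⟨n', hn'⟩ := exists_ne (0 : N')
    obtain ⟨p₁, h₁₁, h₁₂, h₁₃⟩ := hπ n 0 0
    obtain ⟨p₂, h₂₁, h₂₂, h₂₃⟩ := hπ 0 n 0
    obtain ⟨p₃, h₃₁, h₃₂, h₃₃⟩ := hπ 0 0 n'
    refine exists_eq_of_preserves hb hβ₀ ht φ (fun w s => ?_) (fun w hw γ => ?_)
    -- Applying `T` first and using `π₁` has the same value as using `π₂`; `g` transports this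
    -- identity to `φ`.
    · have e : (double N N' π₁ π₂ π₃ b t).arrow X p₁ (fun s => t s • w s) =
          (double N N' π₁ π₂ π₃ b t).arrow X p₂ w := by
        funext j
        rcases j with s | γ
        · change (_ : N ⊗[K] X) = _
          rw [arrow_double_inl, arrow_double_inl, h₁₁, h₁₂, h₂₁, h₂₂, TensorProduct.zero_tmul,
            TensorProduct.zero_tmul, add_zero, zero_add]
        · change (_ : N' ⊗[K] X) = _
          rw [arrow_double_inr, arrow_double_inr, h₁₃, h₂₃, TensorProduct.zero_tmul,
            TensorProduct.zero_tmul]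
      have e' := congrFun ((hg p₁ _).symm.trans ((congrArg g e).trans (hg p₂ w))) (.inl s)
      change (_ : N ⊗[K] Y) = _ at e'
      rw [arrow_double_inl, arrow_double_inl, h₁₁, h₁₂, h₂₁, h₂₂, TensorProduct.zero_tmul,
        TensorProduct.zero_tmul, add_zero, zero_add] at e'
      exact TensorProduct.tmul_right_injective_of_ne_zero hn e'
    · have e : (double N N' π₁ π₂ π₃ b t).arrow X p₃ w = 0 := by
        funext j
        rcases j with s | γ
        · change _ = (0 : N ⊗[K] X)
          rw [arrow_double_inl, h₃₁, h₃₂, TensorProduct.zero_tmul, TensorProduct.zero_tmul,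
            add_zero]
        · change _ = (0 : N' ⊗[K] X)
          rw [arrow_double_inr, hw, add_sub_cancel_left, sub_self, TensorProduct.tmul_zero]
      have e' := congrFun ((hg p₃ w).symm.trans ((congrArg g e).trans (map_zero g))) (.inr γ)
      change _ = (0 : N' ⊗[K] Y) at e'
      rw [arrow_double_inr, h₃₃, ← TensorProduct.tmul_zero _ n'] at e'
      have := TensorProduct.tmul_right_injective_of_ne_zero hn' e'
      rwa [sub_sub, sub_eq_zero] at this
  nonempty := ⟨.inl true⟩

end Double

/-! ### Five components and the four-subspace encoding of an operator -/

section Five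

variable {β : Type u} [Fintype β] [DecidableEq β] (N : Fin 5 → LieSubmodule K L (I ⊗[K] M))
  (π : ∀ i, (I ⊗[K] M) →ₗ⁅K, L⁆ N i) (b : β → B) (t : Bool ⊕ β → K)

/-- The coefficients of the first four arrows of `five`. -/
def fiveCoeff (s : Bool ⊕ β) : Fin 4 → (Bool ⊕ β) ⊕ (Bool ⊕ β) → B :=
  ![Pi.single (.inl s) 1, Pi.single (.inr s) 1, Pi.single (.inl s) 1 - Pi.single (.inr s) 1,
    Pi.single (.inr s) 1 - Pi.single (.inl s) (algebraMap K B (t s))]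

/-- The arrows for five components. -/
abbrev five : ArrowData K L I M B where
  σ := (Bool ⊕ β) ⊕ (Bool ⊕ β)
  J := (Fin 4 × (Bool ⊕ β)) ⊕ β
  R := Unit
  N := Sum.elim (fun q => N q.1.castSucc) fun _ => N 4
  π
    | .inl q => fun _ => π q.1.castSucc
    | .inr _ => fun _ => π 4
  A
    | .inl q => fun _ => fiveCoeff t q.2 q.1
    | .inr γ => fun _ => Sum.elim (graphCoeff b γ) 0

variable {X : Type u} [AddCommGroup X] [Module K X] [Module B X]

/-- The first four quotient maps of `five`. -/
def fiveValue (w : (Bool ⊕ β) ⊕ (Bool ⊕ β) → X) (s : Bool ⊕ β) : Fin 4 → X :=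
  ![w (.inl s), w (.inr s), w (.inl s) - w (.inr s), w (.inr s) - t s • w (.inl s)]

theorem arrow_five_inl [IsScalarTower K B X] (p : I ⊗[K] M) (w : (Bool ⊕ β) ⊕ (Bool ⊕ β) → X) (i : Fin 4)
    (s : Bool ⊕ β) :
    @Eq (N i.castSucc ⊗[K] X) ((five N π b t).arrow X p w (.inl (i, s)))
      (π i.castSucc p ⊗ₜ fiveValue t w s i) := by
  change (∑ _ : Unit, π i.castSucc p ⊗ₜ[K] ∑ k, (fiveCoeff t s i : _ → B) k • w k :
    N i.castSucc ⊗[K] X) = _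
  rw [Fintype.sum_unique]
  congr 1
  fin_cases i
  · change ∑ k, (Pi.single (.inl s) 1 : _ → B) k • w k = w (.inl s)
    rw [sum_single_smul, one_smul]
  · change ∑ k, (Pi.single (.inr s) 1 : _ → B) k • w k = w (.inr s)
    rw [sum_single_smul, one_smul]
  · change ∑ k, (Pi.single (.inl s) 1 - Pi.single (.inr s) 1 : _ → B) k • w k =
      w (.inl s) - w (.inr s)
    simp only [Pi.sub_apply, sub_smul, Finset.sum_sub_distrib, sum_single_smul, one_smul]
  · change ∑ k, (Pi.single (.inr s) 1 - Pi.single (.inl s) (algebraMap K B (t s)) : _ → B) k • w k =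
      w (.inr s) - t s • w (.inl s)
    simp only [Pi.sub_apply, sub_smul, Finset.sum_sub_distrib, sum_single_smul, one_smul,
      algebraMap_smul]

theorem arrow_five_inr (p : I ⊗[K] M) (w : (Bool ⊕ β) ⊕ (Bool ⊕ β) → X) (γ : β) :
    @Eq (N 4 ⊗[K] X) ((five N π b t).arrow X p w (.inr γ))
      (π 4 p ⊗ₜ (w (.inl (.inr γ)) - w (.inl (.inl false)) - b γ • w (.inl (.inl true)))) := by
  change (∑ _ : Unit, π 4 p ⊗ₜ[K] ∑ k, (Sum.elim (graphCoeff b γ) 0 : _ → B) k • w k :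
    N 4 ⊗[K] X) = _
  rw [Fintype.sum_unique, Fintype.sum_sum_type]
  simp only [Sum.elim_inl, Sum.elim_inr, Pi.zero_apply, zero_smul, Finset.sum_const_zero, add_zero]
  rw [sum_graphCoeff_smul b γ fun s => w (.inl s)]

variable {N π b t}

/-- For `p` whose only nonzero projection is the `i`-th, `arrow` vanishes exactly on the `i`-th
subspace of the quadruple. Since `g` carries zero to zero, `φ` preserves that subspace. -/
theorem fiveValue_eq_zero_of_forall [IsScalarTower K B X] {Y : Type u} [AddCommGroup Y] [Module K Y] [Module B Y]
    [IsScalarTower K B Y] (hN : ∀ i, Nontrivial (N i))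
    (hπ : ∀ n : ∀ i, N i, ∃ p, ∀ i, π i p = n i)
    (φ : ((Bool ⊕ β) ⊕ (Bool ⊕ β) → X) →ₗ[K] ((Bool ⊕ β) ⊕ (Bool ⊕ β) → Y))
    (g : (∀ j, (five N π b t).N j ⊗[K] X) →ₗ[K] (∀ j, (five N π b t).N j ⊗[K] Y))
    (hg : ∀ p w, g ((five N π b t).arrow X p w) = (five N π b t).arrow Y p (φ w))
    (i : Fin 4) (w : (Bool ⊕ β) ⊕ (Bool ⊕ β) → X) (hw : ∀ s, fiveValue t w s i = 0)
    (s : Bool ⊕ β) : fiveValue t (φ w) s i = 0 := by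
  have h4 : ∀ k : Fin 4, k.castSucc ≠ (4 : Fin 5) := by decide
  obtain ⟨n, hn⟩ := exists_ne (0 : N i.castSucc)
  obtain ⟨p, hp⟩ := hπ (Pi.single i.castSucc n)
  have e : (five N π b t).arrow X p w = 0 := by
    funext j
    rcases j with ⟨k, s⟩ | γ
    · change _ = (0 : N k.castSucc ⊗[K] X)
      rw [arrow_five_inl, hp]
      rcases eq_or_ne k i with rfl | hk
      · rw [hw, TensorProduct.tmul_zero]
      · rw [Pi.single_eq_of_ne (fun h => hk (Fin.castSucc_injective _ h)), TensorProduct.zero_tmul]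
    · change _ = (0 : N 4 ⊗[K] X)
      rw [arrow_five_inr, hp, Pi.single_eq_of_ne (h4 i).symm, TensorProduct.zero_tmul]
  have e' := congrFun ((hg p w).symm.trans ((congrArg g e).trans (map_zero g))) (.inl (i, s))
  change _ = (0 : N i.castSucc ⊗[K] Y) at e'
  rw [arrow_five_inl, hp, Pi.single_eq_same, ← TensorProduct.tmul_zero _ n] at e'
  exact TensorProduct.tmul_right_injective_of_ne_zero hn e'

/-- With `U = X^(Bool ⊕ β)`, preserving `0 ⊕ U`, `U ⊕ 0`, the diagonal and the graph of `T` means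
having the form `ψ ⊕ ψ` with `ψ` commuting with `T`. The fifth component makes `ψ` preserve the
subspace of all `(u, v, u + b γ v)`. -/
theorem isWild_five (hN : ∀ i, Nontrivial (N i))
    (hπ : ∀ n : ∀ i, N i, ∃ p, ∀ i, π i p = n i)
    (hb : Algebra.adjoin K (Set.range b) = ⊤) {β₀ : β} (hβ₀ : b β₀ = 1)
    (ht : Function.Injective t) : (five N π b t).IsWild where
  exists_proj s := by
    have hne : ∀ i, π i ≠ 0 := fun i h => by
      obtain ⟨n, hn⟩ := exists_ne (0 : N i)
      obtain ⟨p, hp⟩ := hπ (Pi.single i n)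
      have := hp i
      rw [h, Pi.single_eq_same] at this
      exact hn this.symm
    rcases s with s | s
    · exact ⟨.inl (0, s), π 0, hne 0, fun X _ _ _ _ p w => arrow_five_inl N π b t p w 0 s⟩
    · exact ⟨.inl (1, s), π 1, hne 1, fun X _ _ _ _ p w => arrow_five_inl N π b t p w 1 s⟩
  exists_arrow X _ _ _ _ j n x := by
    have h4 : ∀ k : Fin 4, k.castSucc ≠ (4 : Fin 5) := by decide
    rcases j with ⟨i, s⟩ | γ
    · change N i.castSucc at n
      obtain ⟨p, hp⟩ := hπ (Pi.single i.castSucc n)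
      have hv : ∃ w : (Bool ⊕ β) ⊕ (Bool ⊕ β) → X, ∀ s', fiveValue t w s' i =
          (Pi.single s x : Bool ⊕ β → X) s' := by
        fin_cases i
        · exact ⟨Sum.elim (Pi.single s x) 0, fun s' => rfl⟩
        · exact ⟨Sum.elim 0 (Pi.single s x), fun s' => rfl⟩
        · exact ⟨Sum.elim (Pi.single s x) 0, fun s' => sub_zero _⟩
        · refine ⟨Sum.elim 0 (Pi.single s x), fun s' => ?_⟩
          change (Pi.single s x : Bool ⊕ β → X) s' - t s' • (0 : X) = _
          rw [smul_zero, sub_zero]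
      obtain ⟨w, hw⟩ := hv
      refine ⟨p, w, ?_, ?_⟩
      · change (_ : N i.castSucc ⊗[K] X) = n ⊗ₜ x
        rw [arrow_five_inl, hp, hw, Pi.single_eq_same, Pi.single_eq_same]
      · rintro (⟨k, s'⟩ | γ) hne
        · change _ = (0 : N k.castSucc ⊗[K] X)
          rw [arrow_five_inl, hp]
          rcases eq_or_ne k i with rfl | hk
          · have hs : s' ≠ s := fun h => hne (by rw [h])
            rw [hw, Pi.single_eq_of_ne (M := fun _ : Bool ⊕ β => X) hs, TensorProduct.tmul_zero]
          · rw [Pi.single_eq_of_ne (fun h => hk (Fin.castSucc_injective _ h)),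
              TensorProduct.zero_tmul]
        · change _ = (0 : N 4 ⊗[K] X)
          rw [arrow_five_inr, hp, Pi.single_eq_of_ne (h4 i).symm, TensorProduct.zero_tmul]
    · change N 4 at n
      obtain ⟨p, hp⟩ := hπ (Pi.single 4 n)
      refine ⟨p, Pi.single (.inl (.inr γ)) x, ?_, ?_⟩
      · change (_ : N 4 ⊗[K] X) = n ⊗ₜ x
        rw [arrow_five_inr, hp, Pi.single_eq_same]
        simp
      · rintro (⟨k, s'⟩ | γ') hne
        · change _ = (0 : N k.castSucc ⊗[K] X)
          rw [arrow_five_inl, hp, Pi.single_eq_of_ne (h4 k), TensorProduct.zero_tmul]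
        · have hγ : γ' ≠ γ := fun h => hne (congrArg _ h)
          change _ = (0 : N 4 ⊗[K] X)
          rw [arrow_five_inr]
          simp [hγ]
  full X Y _ _ _ _ _ _ _ _ φ g hg := by
    have h4 : ∀ k : Fin 4, k.castSucc ≠ (4 : Fin 5) := by decide
    have key := fiveValue_eq_zero_of_forall hN hπ φ g hg
    have k₀ : ∀ v s, φ (Sum.elim 0 v) (.inl s) = 0 := fun v s => key 0 _ (fun _ => rfl) s
    have k₁ : ∀ v s, φ (Sum.elim v 0) (.inr s) = 0 := fun v s => key 1 _ (fun _ => rfl) s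
    have k₂ : ∀ v s, φ (Sum.elim v v) (.inl s) = φ (Sum.elim v v) (.inr s) := fun v s =>
      sub_eq_zero.1 (key 2 _ (fun _ => sub_self _) s)
    have k₃ : ∀ (v : Bool ⊕ β → X) s, φ (Sum.elim v fun s => t s • v s) (.inr s) =
        t s • φ (Sum.elim v fun s => t s • v s) (.inl s) := fun v s =>
      sub_eq_zero.1 (key 3 _ (fun _ => sub_self _) s)
    have hadd : ∀ v v' : Bool ⊕ β → X, (Sum.elim v v' : (Bool ⊕ β) ⊕ (Bool ⊕ β) → X) =
        Sum.elim v (0 : Bool ⊕ β → X) + Sum.elim (0 : Bool ⊕ β → X) v' :=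
      fun v v' => by
        funext i
        rcases i with i | i <;> simp
    let inl : (Bool ⊕ β → X) →ₗ[K] ((Bool ⊕ β) ⊕ (Bool ⊕ β) → X) :=
      { toFun := fun v => Sum.elim v 0
        map_add' := fun v v' => by
          funext i
          rcases i with i | i <;> simp
        map_smul' := fun c v => by
          funext i
          rcases i with i | i <;> simp }
    let ψ : (Bool ⊕ β → X) →ₗ[K] (Bool ⊕ β → Y) :=
      LinearMap.pi fun s => LinearMap.proj (.inl s) ∘ₗ φ ∘ₗ inl
    have h₁ : ∀ v v' s, φ (Sum.elim v v') (.inl s) = ψ v s := fun v v' s => by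
      rw [hadd, map_add, Pi.add_apply, k₀, add_zero]
      rfl
    have h₂ : ∀ v v' s, φ (Sum.elim v v') (.inr s) = ψ v' s := fun v v' s => by
      rw [hadd, map_add, Pi.add_apply, k₁, zero_add, ← h₁ v' v' s, k₂, hadd v' v', map_add,
        Pi.add_apply, k₁, zero_add]
    obtain ⟨n, hn⟩ := exists_ne (0 : N 4)
    obtain ⟨p, hp⟩ := hπ (Pi.single 4 n)
    obtain ⟨h, hh⟩ := exists_eq_of_preserves hb hβ₀ ht ψ
      (fun v s => by rw [← h₂ v, k₃, h₁]) (fun v hv γ => by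
        have e : (five N π b t).arrow X p (Sum.elim v 0) = 0 := by
          funext j
          rcases j with ⟨k, s⟩ | γ
          · change _ = (0 : N k.castSucc ⊗[K] X)
            rw [arrow_five_inl, hp, Pi.single_eq_of_ne (h4 k), TensorProduct.zero_tmul]
          · change _ = (0 : N 4 ⊗[K] X)
            rw [arrow_five_inr, Sum.elim_inl, Sum.elim_inl, Sum.elim_inl, hv, add_sub_cancel_left,
              sub_self, TensorProduct.tmul_zero]
        have e' := congrFun ((hg p _).symm.trans ((congrArg g e).trans (map_zero g))) (.inr γ)
        change _ = (0 : N 4 ⊗[K] Y) at e'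
        rw [arrow_five_inr, hp, Pi.single_eq_same,
          ← TensorProduct.tmul_zero _ n] at e'
        have := TensorProduct.tmul_right_injective_of_ne_zero hn e'
        rwa [sub_sub, sub_eq_zero] at this)
    refine ⟨h, fun w s => ?_⟩
    rw [← Sum.elim_comp_inl_inr w]
    rcases s with s | s
    · rw [h₁, hh]
      rfl
    · rw [h₂, hh]
      rfl
  nonempty := ⟨.inl (.inl true)⟩

end Five

end ArrowData

/-! ### Projections onto the components of a direct sum decomposition -/

/-- The configurations use the decomposition in this form: the projections are equivariant and their
values can be prescribed independently. -/
theorem LieSubmodule.exists_projections {K L V ι : Type*} [Field K] [LieRing L] [LieAlgebra K L]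
    [AddCommGroup V] [Module K V] [LieRingModule L V] [LieModule K L V] [Finite ι]
    {N : ι → LieSubmodule K L V} (hi : iSupIndep N) (hs : ⨆ i, N i = ⊤) :
    ∃ π : ∀ i, V →ₗ⁅K, L⁆ N i, ∀ n : ∀ i, N i, ∃ p, ∀ i, π i p = n i := by
  classical
  have := Fintype.ofFinite ι
  have hint : DirectSum.IsInternal fun i => (N i).toSubmodule := by
    rw [DirectSum.isInternal_submodule_iff_iSupIndep_and_iSup_eq_top]
    refine ⟨LieSubmodule.iSupIndep_toSubmodule.2 hi, ?_⟩
    rw [← LieSubmodule.iSup_toSubmodule, hs, LieSubmodule.top_toSubmodule]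
  let e : (∀ i, N i) →ₗ[K] V := ∑ i, (N i).toSubmodule.subtype ∘ₗ LinearMap.proj i
  have he : ∀ n, e n = ∑ i, (n i : V) := fun n => by simp [e]
  have hbij : Function.Bijective e := by
    have h : ∀ n, e n = DirectSum.coeAddMonoidHom (fun i => (N i).toSubmodule)
        (DirectSum.addEquivProd (fun i => (N i).toSubmodule) |>.symm n) := fun n => by
      rw [he, DirectSum.coeAddMonoidHom_eq_dfinsuppSum, DFinsupp.sum_eq_sum_fintype _ (by simp)]
      rfl
    have h' : (e : (∀ i, N i) → V) = DirectSum.coeAddMonoidHom (fun i => (N i).toSubmodule) ∘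
        (DirectSum.addEquivProd (fun i => (N i).toSubmodule)).symm := funext h
    rw [h']
    exact Function.Bijective.comp hint (AddEquiv.bijective _)
  let E := LinearEquiv.ofBijective e hbij
  have hlie : ∀ (x : L) v i, E.symm ⁅x, v⁆ i = ⁅x, E.symm v i⁆ := fun x v i => by
    obtain ⟨n, rfl⟩ := E.surjective v
    have h : ⁅x, E n⁆ = E fun i => ⁅x, n i⁆ := by
      change ⁅x, e n⁆ = e _
      rw [he, he, lie_sum]
      rfl
    rw [h, E.symm_apply_apply, E.symm_apply_apply]
  refine ⟨fun i => { LinearMap.proj i ∘ₗ E.symm.toLinearMap with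
    map_lie' := fun {x v} => hlie x v i }, fun n => ⟨E n, fun i => ?_⟩⟩
  exact congrFun (E.symm_apply_apply n) i

theorem exists_fintype_adjoin_eq_top (K B : Type u) [Field K] [Ring B] [Algebra K B]
    [Algebra.FiniteType K B] : ∃ (β : Type u) (_ : Fintype β) (b : β → B) (β₀ : β),
      Algebra.adjoin K (Set.range b) = ⊤ ∧ b β₀ = 1 := by
  classical
  obtain ⟨s, hs⟩ := ‹Algebra.FiniteType K B›.out
  -- `1` is added to the generators to serve as the entry `b β₀`.
  refine ⟨(insert 1 s : Finset B), inferInstance, Subtype.val,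
    ⟨1, Finset.mem_insert_self 1 s⟩, eq_top_iff.2 ?_, rfl⟩
  rw [← hs]
  exact Algebra.adjoin_mono fun x hx => ⟨⟨x, Finset.mem_insert_of_mem hx⟩, rfl⟩

theorem exists_injective_of_finite (σ K : Type*) [Finite σ] [Infinite K] :
    ∃ t : σ → K, Function.Injective t := by
  have := Fintype.ofFinite σ
  exact ⟨fun s => Infinite.natEmbedding K (Fintype.equivFin σ s),
    (Infinite.natEmbedding K).injective.comp
      (Fin.val_injective.comp (Fintype.equivFin σ).injective)⟩

/-! ### The criterion -/

section Criterion

variable {K L I M : Type u} [Field K] [IsAlgClosed K]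
    [LieRing L] [LieAlgebra K L]
    [AddCommGroup I] [Module K I] [LieRingModule L I] [LieModule K L I] [FiniteDimensional K I]
    [AddCommGroup M] [Module K M] [LieRingModule L M] [LieModule K L M] [FiniteDimensional K M]
    [LieModule.IsIrreducible K L M]

theorem isControlledWild_of_five (N : Fin 5 → LieSubmodule K L (I ⊗[K] M))
    (hN : ∀ i, Nontrivial (N i)) (π : ∀ i, (I ⊗[K] M) →ₗ⁅K, L⁆ N i)
    (hπ : ∀ n : ∀ i, N i, ∃ p, ∀ i, π i p = n i) :
    IsControlledWild K (SemidirectModule K L I) := by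
  classical
  intro B _ _ _
  obtain ⟨β, _, b, β₀, hb, hβ₀⟩ := exists_fintype_adjoin_eq_top K B
  -- An algebraically closed field is infinite, so it has enough distinct eigenvalues.
  obtain ⟨t, ht⟩ := exists_injective_of_finite (Bool ⊕ β) K
  exact (ArrowData.isWild_five hN hπ hb hβ₀ ht).exists_functor

theorem isControlledWild_of_double (N N' : LieSubmodule K L (I ⊗[K] M)) [Nontrivial N]
    [Nontrivial N'] (π₁ π₂ : (I ⊗[K] M) →ₗ⁅K, L⁆ N) (π₃ : (I ⊗[K] M) →ₗ⁅K, L⁆ N')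
    (hπ : ∀ n₁ n₂ n₃, ∃ p, π₁ p = n₁ ∧ π₂ p = n₂ ∧ π₃ p = n₃) :
    IsControlledWild K (SemidirectModule K L I) := by
  classical
  intro B _ _ _
  obtain ⟨β, _, b, β₀, hb, hβ₀⟩ := exists_fintype_adjoin_eq_top K B
  obtain ⟨t, ht⟩ := exists_injective_of_finite (Bool ⊕ β) K
  exact (ArrowData.isWild_double hπ hb hβ₀ ht).exists_functor

theorem isControlledWild_of_decomposition {ι : Type*} [Finite ι]
    {N : ι → LieSubmodule K L (I ⊗[K] M)} (hN : IsIndecomposableDecomposition N)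
    (h : (∃ e : Fin 5 → ι, Function.Injective e) ∨
      ∃ i j k, i ≠ j ∧ i ≠ k ∧ j ≠ k ∧ IsoComponents N i j) :
    IsControlledWild K (SemidirectModule K L I) := by
  classical
  obtain ⟨π, hπ⟩ := LieSubmodule.exists_projections hN.independent hN.sup_eq_top
  have hnt : ∀ i, Nontrivial (N i) := fun i => (hN.indecomposable i).1
  rcases h with ⟨e, he⟩ | ⟨i, j, k, hij, hik, hjk, ⟨f⟩⟩
  · refine isControlledWild_of_five (fun a => N (e a)) (fun a => hnt _) (fun a => π (e a))
      fun n => ?_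
    obtain ⟨p, hp⟩ := hπ fun i => if h : ∃ a, e a = i then h.choose_spec ▸ n h.choose else 0
    refine ⟨p, fun a => ?_⟩
    rw [hp, dif_pos ⟨a, rfl⟩]
    have key : ∀ (a' : Fin 5) (h : e a' = e a), (h ▸ n a' : N (e a)) = n a := fun a' h => by
      obtain rfl := he h
      rfl
    exact key _ _
  · have := hnt i
    have := hnt k
    -- The isomorphism `f` carries the projection onto `N j` to a second projection onto `N i`,
    -- independent of the first.
    refine isControlledWild_of_double (N i) (N k) (π i)
      ((f.symm : N j →ₗ⁅K, L⁆ N i).comp (π j)) (π k) fun n₁ n₂ n₃ => ?_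
    obtain ⟨p, hp⟩ := hπ (Function.update (Function.update (Pi.single i n₁) j (f n₂)) k n₃)
    refine ⟨p, ?_, ?_, ?_⟩
    · rw [hp, Function.update_of_ne hik, Function.update_of_ne hij, Pi.single_eq_same]
    · rw [LieModuleHom.comp_apply, hp, Function.update_of_ne hjk, Function.update_self]
      exact f.symm_apply_apply n₂
    · rw [hp, Function.update_self]

end Criterion

theorem IsoComponents.trans_symm {K L V ι : Type*} [Field K] [LieRing L] [LieAlgebra K L]
    [AddCommGroup V] [Module K V] [LieRingModule L V] [LieModule K L V]
    {N : ι → LieSubmodule K L V} {i j k : ι} (hj : IsoComponents N i j)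
    (hk : IsoComponents N i k) : IsoComponents N j k :=
  hj.elim fun f => hk.elim fun g => ⟨f.symm.trans g⟩

theorem mainTheorem5 {K L I M : Type u} [Field K] [IsAlgClosed K] [CharZero K]
    [LieRing L] [LieAlgebra K L] [FiniteDimensional K L] [LieAlgebra.IsSemisimple K L]
    [AddCommGroup I] [Module K I] [LieRingModule L I] [LieModule K L I] [FiniteDimensional K I]
    [AddCommGroup M] [Module K M] [LieRingModule L M] [LieModule K L M] [FiniteDimensional K M]
    [LieModule.IsIrreducible K L M]
    {ι : Type*} [Finite ι] (N : ι → LieSubmodule K L (I ⊗[K] M))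
    (hN : IsIndecomposableDecomposition N)
    (h : (∃ e : Fin 5 → ι, ∀ a b, a ≠ b → ¬ IsoComponents N (e a) (e b)) ∨
      (∃ i, 3 ≤ componentMultiplicity N i) ∨
      (∃ i j, componentMultiplicity N i = 2 ∧ ¬ IsoComponents N i j)) :
    IsControlledWild K (SemidirectModule K L I) := by
  refine isControlledWild_of_decomposition hN ?_
  rcases h with ⟨e, he⟩ | ⟨i, hi⟩ | ⟨i, j, hi, hj⟩
  · refine .inl ⟨e, fun a b hab => by_contra fun hne => he a b hne ?_⟩
    rw [hab]
    exact ⟨LieModuleEquiv.refl⟩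
  -- Of three components isomorphic to `N i`, two form the isomorphic pair and the last serves as
  -- the third summand.
  · have := Fintype.ofFinite {j : ι // IsoComponents N i j}
    rw [componentMultiplicity, Nat.card_eq_fintype_card] at hi
    obtain ⟨a, b, c, hab, hac, hbc⟩ := Fintype.two_lt_card_iff.1 hi
    exact .inr ⟨a, b, c, fun h => hab (Subtype.ext h), fun h => hac (Subtype.ext h),
      fun h => hbc (Subtype.ext h), a.2.trans_symm b.2⟩
  · have := Fintype.ofFinite {j : ι // IsoComponents N i j}
    rw [componentMultiplicity, Nat.card_eq_fintype_card] at hi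
    obtain ⟨a, b, hab⟩ := Fintype.one_lt_card_iff.1 (hi ▸ one_lt_two)
    exact .inr ⟨a, b, j, fun h => hab (Subtype.ext h), fun h => hj (h ▸ a.2),
      fun h => hj (h ▸ b.2), a.2.trans_symm b.2⟩
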